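/- Equip $\mathbb{R}^d$ with the sup norm, let $B_1=[-1,1]^d$, and write $T_x(y)=y-x$ and $S_t(y)=e^ty$ for $x\in\mathbb{R}^d$, $t\in\mathbb{R}$; the push-forward of a measure $\mu$ through $f$ is $f\mu$. For a Radon measure $\mu$ on $\mathbb{R}^d$ with $\mu(B_1)>0$ put $\mu^*=\mu/\mu(B_1)$ and let $\mu^\square=\mu(B_1)^{-1}\mu|_{B_1}\in\mathcal{P}(B_1)$, where $\mathcal P(X)$ denotes the space of probability measures on $X$ (with the weak-* topology if $X$ is compact metric). Put $T_x^*\mu=(T_x\mu)^*$, $S_t^*\mu=(S_t\mu)^*$, $S_t^\square\mu=(S_t\mu)^\square$. Spaces of Radon measures carry the Borel $\sigma$-algebra of the weak-* topology. *Distributions.* Let $\mathcal{M}_0^*$ be the set of Radon measures $\mu$ on $\mathbb{R}^d$ with $\mu(B_1)=1$ and $0\in\operatorname{supp}\mu$; $S^*=(S_t^*)_{t\in\mathbb{R}}$ acts on it. A fractal distribution (FD) is a probability measure $P$ on $\mathcal{M}_0^*$ that is $S^*$-invariant and quasi-Palm, i.e. for every bounded open neighborhood $U$ of $0$ the measures $P$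 and $\int\langle\mu\rangle_U\,dP(\mu)$ have the same null sets, where $\langle\mu\rangle_U=\int_U\delta_{T_x^*\mu}\,d\mu(x)$. It is an ergodic fractal distribution (EFD) if moreover $P(A)\in\{0,1\}$ for every measurable $A$ with $P((S_t^*)^{-1}A\,\triangle\,A)=0$ for all $t\in\mathbb{R}$. The restricted version $P^\square$ of $P$ is its push-forward through $\mu\mapsto\mu^\square$. *Ergodic components.* Let $\mathcal{I}$ be the $\sigma$-algebra of $S^*$-invariant measurable subsets of $\mathcal{M}_0^*$. An ergodic decomposition of $P$ is an $\mathcal{I}$-measurable map $\mu\mapsto P_\mu\in\mathcal{P}(\mathcal{M}_0^*)$ such that $P=\int P_\mu\,dP(\mu)$, such that for $P$-a.e. $\mu$ the distribution $P_\mu$ is $S^*$-invariant and ergodic, and such that for every $A\in\mathcal{I}$ we have $P_\mu(A)=1$ for $P$-a.e. $\mu\in A$. The distribution $P_\mu$ is called the ergodic component of $P$ to which $\mu$ belongs. *Uniformly scaling measures.* For a Radon measure $\mu$, $x\in\operatorname{supp}\mu$ and $T>0$ let $$\langle\mu\rangle_{x,T}=\frac1T\int_0^T\delta_{S_t^\square(T_x\mu)}\,dt\in\mathcal{P}(\mathcal{P}(B_1)).$$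 $\mu$ is a uniformly scaling measure (USM) generating $Q\in\mathcal{P}(\mathcal{P}(B_1))$ if for $\mu$-a.e. $x$ we have $x\in\operatorname{supp}\mu$ and $\langle\mu\rangle_{x,T}\to Q$ in the weak-* topology as $T\to\infty$. **Theorem.** Let $P$ be a fractal distribution on $\mathbb{R}^d$. 1. $P$ has an ergodic decomposition, and for every ergodic decomposition $\mu\mapsto P_\mu$ of $P$, $P$-a.e. $\mu$ is a USM generating (the restricted version $P_\mu^\square$ of) the ergodic component $P_\mu$ to which $\mu$ belongs. 2. If $P$ is an ergodic fractal distribution, then $P$-a.e. $\mu$ is a USM generating (the restricted version $P^\square$ of) $P$. -/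

import Mathlib

open MeasureTheory Filter Topology Set

namespace FractalDist

noncomputable section

/-! ### Measures on `ℝ^d` and their normalizations

`Fin d → ℝ` carries the sup norm, so that the closed unit ball is `[-1,1]^d`. A Radon measure on
`ℝ^d` is a locally finite Borel measure. Spaces of measures carry Mathlib's sigma-algebra generated
by the evaluations `μ ↦ μ A`, `A` Borel; on Radon measures this is the Borel sigma-algebra of the
weak-* topology. -/

/-- The closed unit ball `B₁ = [-1,1]^d`. -/
def unitBall (d : ℕ) : Set (Fin d → ℝ) := Metric.closedBall 0 1

/-- `μ^* = μ / μ(B₁)`. -/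
def normStar {d : ℕ} (μ : Measure (Fin d → ℝ)) : Measure (Fin d → ℝ) := (μ (unitBall d))⁻¹ • μ

/-- `T_x μ`, the push-forward of `μ` through `T_x(y) = y - x`. -/
def transl {d : ℕ} (x : Fin d → ℝ) (μ : Measure (Fin d → ℝ)) : Measure (Fin d → ℝ) :=
  μ.map (fun y => y - x)

/-- `S_t μ`, the push-forward of `μ` through `S_t(y) = e^t y`. -/
def scale {d : ℕ} (t : ℝ) (μ : Measure (Fin d → ℝ)) : Measure (Fin d → ℝ) :=
  μ.map (fun y => Real.exp t • y)

/-- `T_x^* μ = (T_x μ)^*`. -/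
def translStar {d : ℕ} (x : Fin d → ℝ) (μ : Measure (Fin d → ℝ)) : Measure (Fin d → ℝ) :=
  normStar (transl x μ)

/-- `S_t^* μ = (S_t μ)^*`. -/
def scaleStar {d : ℕ} (t : ℝ) (μ : Measure (Fin d → ℝ)) : Measure (Fin d → ℝ) :=
  normStar (scale t μ)

theorem measurableSet_unitBall (d : ℕ) : MeasurableSet (unitBall d) :=
  Metric.isClosed_closedBall.measurableSet

/-- The origin as a point of `B₁`. -/
def ballZero (d : ℕ) : unitBall d := ⟨0, by simp [unitBall]⟩

open Classical in
/-- The restriction of `μ` to `B₁`, normalized to mass one. The operation is meant for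
`0 < μ(B₁) < ∞` only; otherwise the value is the point mass at the origin. -/
def boxMeasure {d : ℕ} (μ : Measure (Fin d → ℝ)) : Measure (unitBall d) :=
  if μ (unitBall d) ≠ 0 ∧ μ (unitBall d) ≠ ⊤ then (μ (unitBall d))⁻¹ • μ.comap Subtype.val
  else Measure.dirac (ballZero d)

theorem comap_val_apply {d : ℕ} (μ : Measure (Fin d → ℝ)) {s : Set (unitBall d)}
    (hs : MeasurableSet s) :
    μ.comap (Subtype.val : unitBall d → Fin d → ℝ) s = μ (Subtype.val '' s) :=
  Measure.comap_apply _ Subtype.val_injective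
    (fun _ h => (MeasurableEmbedding.subtype_coe (measurableSet_unitBall d)).measurableSet_image.2 h)
    _ hs

instance isProbabilityMeasure_boxMeasure {d : ℕ} (μ : Measure (Fin d → ℝ)) :
    IsProbabilityMeasure (boxMeasure μ) := by
  by_cases h : μ (unitBall d) ≠ 0 ∧ μ (unitBall d) ≠ ⊤
  · refine ⟨?_⟩
    rw [boxMeasure, if_pos h, Measure.smul_apply, comap_val_apply μ MeasurableSet.univ, image_univ,
      Subtype.range_coe, smul_eq_mul]
    exact ENNReal.inv_mul_cancel h.1 h.2
  · rw [boxMeasure, if_neg h]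
    infer_instance

/-- `μ^□`, as an element of the space of probability measures on `B₁`. -/
def box {d : ℕ} (μ : Measure (Fin d → ℝ)) : ProbabilityMeasure (unitBall d) :=
  ⟨boxMeasure μ, inferInstance⟩

theorem measurable_box (d : ℕ) :
    Measurable (box : Measure (Fin d → ℝ) → ProbabilityMeasure (unitBall d)) := by
  have hev : Measurable fun μ : Measure (Fin d → ℝ) => μ (unitBall d) :=
    Measure.measurable_coe (measurableSet_unitBall d)
  have hset : MeasurableSet
      {μ : Measure (Fin d → ℝ) | μ (unitBall d) ≠ 0 ∧ μ (unitBall d) ≠ ⊤} :=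
    (hev (measurableSet_singleton 0).compl).inter (hev (measurableSet_singleton ⊤).compl)
  refine Measurable.subtype_mk (f := boxMeasure) ?_
  refine Measurable.ite hset ?_ measurable_const
  refine Measure.measurable_of_measurable_coe _ fun s hs => ?_
  have hs' : MeasurableSet (Subtype.val '' s : Set (Fin d → ℝ)) :=
    (MeasurableEmbedding.subtype_coe (measurableSet_unitBall d)).measurableSet_image.2 hs
  simp_rw [Measure.smul_apply, comap_val_apply _ hs, smul_eq_mul]
  exact hev.inv.mul (Measure.measurable_coe hs')

/-! ### Sceneries and generated distributions -/

instance compactSpace_unitBall (d : ℕ) : CompactSpace (unitBall d) :=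
  isCompact_iff_compactSpace.1 (isCompact_closedBall 0 1)

/-- Weakly open sets of probability measures on `B₁` are measurable, so that weak convergence of
distributions on `𝓟(B₁)` makes sense. -/
instance opensMeasurableSpace_probabilityMeasure (d : ℕ) :
    OpensMeasurableSpace (ProbabilityMeasure (unitBall d)) := by
  let g : (BoundedContinuousFunction (unitBall d) NNReal) → ProbabilityMeasure (unitBall d) → NNReal :=
    fun f μ => μ.toFiniteMeasure.testAgainstNN f
  let S : Set (Set (ProbabilityMeasure (unitBall d))) := {A | ∃ f V, IsOpen V ∧ A = g f ⁻¹' V}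
  let := TopologicalSpace.pseudoMetrizableSpacePseudoMetric (ProbabilityMeasure (unitBall d))
  have hS : (inferInstance : TopologicalSpace (ProbabilityMeasure (unitBall d))) =
      TopologicalSpace.generateFrom S := by
    apply le_antisymm
    · refine le_generateFrom ?_
      rintro A ⟨f, V, hV, rfl⟩
      exact hV.preimage (ProbabilityMeasure.continuous_testAgainstNN_eval f)
    · have h1 : @Continuous _ _ (TopologicalSpace.generateFrom S) _
          (fun (μ : ProbabilityMeasure (unitBall d)) f => g f μ) := by
        refine @continuous_pi _ _ _ (TopologicalSpace.generateFrom S) _ _ fun f => ?_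
        refine (@continuous_def _ _ (TopologicalSpace.generateFrom S) _ _).2 fun V hV => ?_
        exact TopologicalSpace.isOpen_generateFrom_of_mem ⟨f, V, hV, rfl⟩
      have h2 := continuous_iff_le_induced.1 h1
      refine h2.trans (le_of_eq ?_)
      have h3 : Topology.IsInducing (fun (μ : ProbabilityMeasure (unitBall d)) f => g f μ) := by
        have h4 : Topology.IsInducing
            (fun (φ : WeakDual NNReal (BoundedContinuousFunction (unitBall d) NNReal)) f => φ f) :=
          ⟨rfl⟩
        have h5 : Topology.IsInducing (FiniteMeasure.toWeakDualBCNN (Ω := unitBall d)) := ⟨rfl⟩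
        exact h4.comp (h5.comp
          (ProbabilityMeasure.toFiniteMeasure_isEmbedding (unitBall d)).isInducing)
      exact h3.eq_induced.symm
  refine ⟨?_⟩
  rw [borel_eq_generateFrom_of_subbasis hS]
  refine MeasurableSpace.generateFrom_le ?_
  rintro A ⟨f, V, hV, rfl⟩
  have hg : Measurable (g f) := by
    change Measurable fun μ : ProbabilityMeasure (unitBall d) =>
      (∫⁻ ω, f ω ∂(μ : Measure (unitBall d))).toNNReal
    exact ((Measure.measurable_lintegral (by fun_prop)).comp
      measurable_subtype_coe).ennreal_toNNReal
  exact hg hV.measurableSet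

/-- The scenery `μ_{x,t}^□ = S_t^□ (T_x μ)` of `μ` at `x`. -/
def scenery {d : ℕ} (μ : Measure (Fin d → ℝ)) (x : Fin d → ℝ) (t : ℝ) :
    ProbabilityMeasure (unitBall d) :=
  box (scale t (transl x μ))

theorem measurable_scenery {d : ℕ} (μ : Measure (Fin d → ℝ)) [IsLocallyFiniteMeasure μ]
    (x : Fin d → ℝ) : Measurable (scenery μ x) := by
  refine (measurable_box d).comp (Measure.measurable_of_measurable_coe _ fun s hs => ?_)
  have hmap : ∀ t : ℝ, scale t (transl x μ) s = μ (Prod.mk t ⁻¹'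
      {p : ℝ × (Fin d → ℝ) | Real.exp p.1 • (p.2 - x) ∈ s}) := by
    intro t
    rw [scale, transl, Measure.map_map (by fun_prop) (by fun_prop),
      Measure.map_apply (by fun_prop) hs]
    rfl
  simp_rw [hmap]
  refine measurable_measure_prodMk_left ?_
  exact (by fun_prop : Measurable fun p : ℝ × (Fin d → ℝ) => Real.exp p.1 • (p.2 - x)) hs

open Classical in
/-- The scenery distribution `⟨μ⟩_{x,T} = (1/T) ∫₀ᵀ δ_{μ_{x,t}^□} dt`, that is, the push-forward of
the uniform probability measure on `[0,T]` through the scenery (a point mass for `T ≤ 0`, which is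
irrelevant). -/
def sceneryMeasure {d : ℕ} (μ : Measure (Fin d → ℝ)) (x : Fin d → ℝ) (T : ℝ) :
    Measure (ProbabilityMeasure (unitBall d)) :=
  if 0 < T then (ENNReal.ofReal T)⁻¹ • (volume.restrict (Icc 0 T)).map (scenery μ x)
  else Measure.dirac (scenery μ x 0)

instance isProbabilityMeasure_sceneryMeasure {d : ℕ} (μ : Measure (Fin d → ℝ))
    [IsLocallyFiniteMeasure μ] (x : Fin d → ℝ) (T : ℝ) :
    IsProbabilityMeasure (sceneryMeasure μ x T) := by
  by_cases hT : 0 < T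
  · refine ⟨?_⟩
    rw [sceneryMeasure, if_pos hT, Measure.smul_apply,
      Measure.map_apply (measurable_scenery μ x) MeasurableSet.univ, preimage_univ,
      Measure.restrict_apply_univ, Real.volume_Icc, sub_zero, smul_eq_mul]
    exact ENNReal.inv_mul_cancel (by simpa using hT) ENNReal.ofReal_ne_top
  · rw [sceneryMeasure, if_neg hT]
    infer_instance

/-- `⟨μ⟩_{x,T}`, as an element of the space of probability measures on `𝓟(B₁)`. -/
def sceneryDist {d : ℕ} (μ : Measure (Fin d → ℝ)) [IsLocallyFiniteMeasure μ] (x : Fin d → ℝ)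
    (T : ℝ) : ProbabilityMeasure (ProbabilityMeasure (unitBall d)) :=
  ⟨sceneryMeasure μ x T, inferInstance⟩

/-- `μ` generates `Q` at the point `x` of its support: `⟨μ⟩_{x,T} → Q` weakly as `T → ∞`. -/
def GeneratesAt {d : ℕ} (μ : Measure (Fin d → ℝ)) [IsLocallyFiniteMeasure μ] (x : Fin d → ℝ)
    (Q : ProbabilityMeasure (ProbabilityMeasure (unitBall d))) : Prop :=
  x ∈ μ.support ∧ Tendsto (fun T : ℝ => sceneryDist μ x T) atTop (𝓝 Q)

/-- `μ` is a uniformly scaling measure and generates `Q`: it generates the one distribution `Q` at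
`μ`-almost every point. -/
def IsUSMGenerating {d : ℕ} (μ : Measure (Fin d → ℝ)) [IsLocallyFiniteMeasure μ]
    (Q : ProbabilityMeasure (ProbabilityMeasure (unitBall d))) : Prop :=
  ∀ᵐ x ∂μ, GeneratesAt μ x Q

/-! ### The scaling flow -/

/-- The set `{μ ∈ 𝓜^* : 0 ∈ supp μ}` on which the operators `S_t^*`, `t ∈ ℝ`, act. -/
abbrev Phase (d : ℕ) : Type :=
  {μ : Measure (Fin d → ℝ) // IsLocallyFiniteMeasure μ ∧ μ (unitBall d) = 1 ∧ 0 ∈ μ.support}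

instance isLocallyFiniteMeasure_phase {d : ℕ} (μ : Phase d) : IsLocallyFiniteMeasure μ.1 := μ.2.1

theorem scale_apply {d : ℕ} (t : ℝ) (μ : Measure (Fin d → ℝ)) {s : Set (Fin d → ℝ)}
    (hs : MeasurableSet s) : scale t μ s = μ ((fun y => Real.exp t • y) ⁻¹' s) :=
  Measure.map_apply (by fun_prop) hs

theorem scaleStar_mem {d : ℕ} (t : ℝ) (μ : Phase d) :
    IsLocallyFiniteMeasure (scaleStar t μ.1) ∧ scaleStar t μ.1 (unitBall d) = 1 ∧
      0 ∈ (scaleStar t μ.1).support := by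
  have hcont : Continuous fun y : Fin d → ℝ => Real.exp t • y := by fun_prop
  have hlf : ∀ K : Set (Fin d → ℝ), IsCompact K → scale t μ.1 K ≠ ⊤ := by
    intro K hK
    rw [scale_apply t _ hK.isClosed.measurableSet]
    have : IsCompact ((fun y : Fin d → ℝ => Real.exp t • y) ⁻¹' K) :=
      (Homeomorph.smulOfNeZero (Real.exp t) (Real.exp_pos t).ne').isCompact_preimage.2 hK
    exact this.measure_lt_top.ne
  have hpos : ∀ V ∈ 𝓝 (0 : Fin d → ℝ), scale t μ.1 V ≠ 0 := by
    intro V hV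
    obtain ⟨W, hWV, hW, h0⟩ := mem_nhds_iff.1 hV
    have h1 : (fun y : Fin d → ℝ => Real.exp t • y) ⁻¹' W ∈ 𝓝 (0 : Fin d → ℝ) :=
      (hW.preimage hcont).mem_nhds (by simpa using h0)
    have h2 := (Measure.mem_support_iff_forall _).1 μ.2.2.2 _ h1
    rw [← scale_apply t _ hW.measurableSet] at h2
    exact (h2.trans_le (measure_mono hWV)).ne'
  have hB0 : scale t μ.1 (unitBall d) ≠ 0 := hpos _ (Metric.closedBall_mem_nhds _ one_pos)
  have hBt : scale t μ.1 (unitBall d) ≠ ⊤ := hlf _ (isCompact_closedBall 0 1)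
  refine ⟨⟨fun x => ⟨Metric.closedBall x 1, Metric.closedBall_mem_nhds _ one_pos, ?_⟩⟩, ?_, ?_⟩
  · rw [scaleStar, normStar, Measure.smul_apply, smul_eq_mul]
    exact ENNReal.mul_lt_top (ENNReal.inv_lt_top.2 (pos_iff_ne_zero.2 hB0))
      (lt_top_iff_ne_top.2 (hlf _ (isCompact_closedBall x 1)))
  · rw [scaleStar, normStar, Measure.smul_apply, smul_eq_mul]
    exact ENNReal.inv_mul_cancel hB0 hBt
  · rw [Measure.mem_support_iff_forall]
    intro V hV
    rw [scaleStar, normStar, Measure.smul_apply, smul_eq_mul]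
    exact ENNReal.mul_pos (ENNReal.inv_ne_zero.2 hBt) (hpos V hV)

/-- The action `t ↦ S_t^*` of `ℝ`. -/
def flow {d : ℕ} (t : ℝ) (μ : Phase d) : Phase d := ⟨scaleStar t μ.1, scaleStar_mem t μ⟩

/-- The sigma-algebra of `S^*`-invariant measurable sets. -/
abbrev invariantSets (d : ℕ) : MeasurableSpace (Phase d) :=
  ⨅ t : ℝ, MeasurableSpace.invariants (flow (d := d) t)

/-! ### Fractal distributions -/

/-- `P` is `S^*`-invariant. -/
def IsScaleInvariant {d : ℕ} (P : ProbabilityMeasure (Phase d)) : Prop :=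
  ∀ t : ℝ, MeasurePreserving (flow t) (P : Measure (Phase d)) (P : Measure (Phase d))

/-- `P` is ergodic for `S^*`: the almost invariant sets have probability `0` or `1`. -/
def IsErgodicDist {d : ℕ} (P : ProbabilityMeasure (Phase d)) : Prop :=
  ∀ A : Set (Phase d), MeasurableSet A →
    (∀ t : ℝ, (P : Measure (Phase d)) (symmDiff (flow t ⁻¹' A) A) = 0) →
      (P : Measure (Phase d)) A = 0 ∨ (P : Measure (Phase d)) A = 1

/-- The `U`-diffusion `⟨μ⟩_U = ∫_U δ_{T_x^* μ} dμ(x)`. -/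
def diffusion {d : ℕ} (U : Set (Fin d → ℝ)) (μ : Measure (Fin d → ℝ)) :
    Measure (Measure (Fin d → ℝ)) :=
  (μ.restrict U).map (fun x => translStar x μ)

/-- `P` is quasi-Palm: `P` and `∫ ⟨μ⟩_U dP(μ)` have the same null sets, for every bounded open
neighborhood `U` of the origin. -/
def IsQuasiPalm {d : ℕ} (P : ProbabilityMeasure (Phase d)) : Prop :=
  ∀ U : Set (Fin d → ℝ), IsOpen U → Bornology.IsBounded U → 0 ∈ U →
    (P : Measure (Phase d)).map Subtype.val ≪
        (P : Measure (Phase d)).bind (fun μ => diffusion U μ.1) ∧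
      (P : Measure (Phase d)).bind (fun μ => diffusion U μ.1) ≪
        (P : Measure (Phase d)).map Subtype.val

/-- Fractal distributions (FDs). -/
def IsFractalDistribution {d : ℕ} (P : ProbabilityMeasure (Phase d)) : Prop :=
  IsScaleInvariant P ∧ IsQuasiPalm P

/-- The restricted version `P^□`, the push-forward of `P` through `μ ↦ μ^□`. -/
def restricted {d : ℕ} (P : ProbabilityMeasure (Phase d)) :
    ProbabilityMeasure (ProbabilityMeasure (unitBall d)) :=
  P.map (f := fun μ => box μ.1) ((measurable_box d).comp measurable_subtype_coe).aemeasurable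

/-- `μ ↦ κ μ` is an ergodic decomposition of `P` for `S^*`; `κ μ` is then the ergodic component of
`P` to which `μ` belongs. The last field says that `κ μ` is carried by the atom, modulo null sets, of
the sigma-algebra of invariant sets that contains `μ`: almost every point of an invariant set has a
component carried by that set. (That sigma-algebra is not countably generated, and its pointwise
atoms are single orbits.) -/
structure IsErgodicDecomposition {d : ℕ} (P : ProbabilityMeasure (Phase d))
    (κ : Phase d → ProbabilityMeasure (Phase d)) : Prop where
  measurable : Measurable[invariantSets d] κ
  barycenter : (P : Measure (Phase d)).bind (fun μ => (κ μ : Measure (Phase d))) = P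
  ae_invariant : ∀ᵐ μ ∂(P : Measure (Phase d)), IsScaleInvariant (κ μ)
  ae_ergodic : ∀ᵐ μ ∂(P : Measure (Phase d)), IsErgodicDist (κ μ)
  ae_carried : ∀ A : Set (Phase d), MeasurableSet[invariantSets d] A →
    ∀ᵐ μ ∂(P : Measure (Phase d)), μ ∈ A → (κ μ : Measure (Phase d)) A = 1

end

end FractalDist

/-! Fix a continuous function `g` on the space of probability measures on the unit ball. The scenery
of `μ` at the origin is the orbit of `μ` under the scaling flow, restricted to the ball. The
pointwise ergodic theorem therefore gives, for almost every `μ`, convergence of the averages of `g`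
along the scenery at `0`. An ergodic decomposition `κ` is a disintegration of `P` over the invariant
sets (`isInvariantDisintegration_of_carried`), so the limit is the integral of `g` against
`restricted (κ μ)`. By the quasi-Palm property (`ae_translStar_of_ae`) the averages also converge at
`μ`-almost every `x`, but a priori to a limit that depends on `x`.

The core is that this limit, `sceneryLimsup g μ x`, does not depend on `x`. Let `oscillation g μ` be
the mean distance over the unit ball between its values at `y` and at `0`. For every Radon measure,
almost every point is a Lebesgue point, so the oscillation of the measure recentred at such a point
tends to `0` under magnification. The other half of the quasi-Palm property (`ae_of_ae_translStar`)
turns this into a statement about `P`-almost every measure at the origin. By scale invariance the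
expected oscillation is the same at all magnifications, hence it is `0` (`ae_oscillation_eq_zero`).
Zooming out instead of in then gives constancy on all of space (`ae_sceneryLimsup_eq`). A countable
dense family of functions `g` finishes the proof.

Existence of a decomposition uses conditional probabilities on the phase space, which is standard
Borel. Invariance and ergodicity of the components follow from Fubini over the time parameter and
from the ergodic theorem. If `P` is ergodic, the constant map with value `P` is a decomposition, so
the second assertion is a case of the first. -/

namespace FractalDist

noncomputable section

/-! ### Cesàro averages -/

/-- The average of `u` over `[0,T]`. -/
def cesaro (u : ℝ → ℝ) (T : ℝ) : ℝ := T⁻¹ * ∫ t in 0..T, u t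

/-- The upper limit of the averages of `u` over `[0,n]`. -/
def cesaroLimsup (u : ℝ → ℝ) : ℝ := limsup (fun n : ℕ => cesaro u n) atTop

theorem intervalIntegrable_of_bounded {u : ℝ → ℝ} (hu : Measurable u) {C : ℝ}
    (hC : ∀ t, |u t| ≤ C) (a b : ℝ) : IntervalIntegrable u volume a b :=
  (intervalIntegrable_const (c := C)).mono_fun hu.aestronglyMeasurable
    (Eventually.of_forall fun t => by
      simpa [Real.norm_eq_abs] using (hC t).trans (le_abs_self C))

theorem abs_integral_le_of_bounded {u : ℝ → ℝ} {C : ℝ} (hC : ∀ t, |u t| ≤ C) (a b : ℝ) :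
    |∫ t in a..b, u t| ≤ C * |b - a| := by
  rw [← Real.norm_eq_abs]
  exact intervalIntegral.norm_integral_le_of_norm_le_const fun t _ => hC t

theorem abs_cesaro_le {u : ℝ → ℝ} {C : ℝ} (hC : ∀ t, |u t| ≤ C) (T : ℝ) :
    |cesaro u T| ≤ C := by
  have h0 : 0 ≤ C := (abs_nonneg _).trans (hC 0)
  rcases eq_or_ne T 0 with rfl | hT
  · simpa [cesaro] using h0
  · rw [cesaro, abs_mul, abs_inv]
    calc |T|⁻¹ * |∫ t in 0..T, u t| ≤ |T|⁻¹ * (C * |T|) := by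
          gcongr
          simpa using abs_integral_le_of_bounded hC 0 T
      _ = C := by
          have := abs_ne_zero.2 hT
          field_simp

theorem isBoundedUnder_le_of_abs_le {a : ℕ → ℝ} {C : ℝ} (h : ∀ n, |a n| ≤ C) :
    IsBoundedUnder (· ≤ ·) atTop a :=
  isBoundedUnder_of ⟨C, fun n => (abs_le.1 (h n)).2⟩

theorem isCoboundedUnder_le_of_abs_le {a : ℕ → ℝ} {C : ℝ} (h : ∀ n, |a n| ≤ C) :
    IsCoboundedUnder (· ≤ ·) atTop a :=
  IsBoundedUnder.isCoboundedUnder_le (isBoundedUnder_of ⟨-C, fun n => (abs_le.1 (h n)).1⟩)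

theorem abs_cesaroLimsup_le {u : ℝ → ℝ} {C : ℝ} (hC : ∀ t, |u t| ≤ C) :
    |cesaroLimsup u| ≤ C := by
  have h : ∀ n : ℕ, |cesaro u n| ≤ C := fun n => abs_cesaro_le hC n
  rw [abs_le]
  constructor
  · exact le_limsup_of_frequently_le (Frequently.of_forall fun n => (abs_le.1 (h n)).1)
      (isBoundedUnder_le_of_abs_le h)
  · exact limsup_le_of_le (isCoboundedUnder_le_of_abs_le h)
      (Eventually.of_forall fun n => (abs_le.1 (h n)).2)

theorem limsup_le_of_tendsto_sub {a b : ℕ → ℝ} {C : ℝ} (ha : ∀ n, |a n| ≤ C)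
    (hb : ∀ n, |b n| ≤ C) (h : Tendsto (fun n => a n - b n) atTop (𝓝 0)) :
    limsup a atTop ≤ limsup b atTop := by
  refine le_of_forall_pos_lt_add fun ε hε => ?_
  have h1 := eventually_lt_of_limsup_lt (lt_add_of_pos_right (limsup b atTop) (half_pos hε))
    (isBoundedUnder_le_of_abs_le hb)
  have h2 := h.eventually (gt_mem_nhds (show 0 < ε / 4 by positivity))
  have h3 : limsup a atTop ≤ limsup b atTop + ε / 2 + ε / 4 :=
    limsup_le_of_le (isCoboundedUnder_le_of_abs_le ha)
      (by filter_upwards [h1, h2] with n h1 h2; linarith)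
  linarith

/-- The windows `[s, n+s]` and `[0, n]` differ by two pieces of length `|s|`, which is negligible
after division by `n`. -/
theorem tendsto_cesaro_shift_sub {u : ℝ → ℝ} (hu : Measurable u) {C : ℝ} (hC : ∀ t, |u t| ≤ C)
    (s : ℝ) :
    Tendsto (fun n : ℕ => cesaro (fun t => u (t + s)) n - cesaro u n) atTop (𝓝 0) := by
  have hi := intervalIntegrable_of_bounded hu hC
  have hb : ∀ n : ℕ, ‖cesaro (fun t => u (t + s)) n - cesaro u n‖ ≤ (2 * C * |s|) * (n : ℝ)⁻¹ := by
    intro n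
    have e : (∫ t in (0 : ℝ)..n, u (t + s)) - ∫ t in (0 : ℝ)..n, u t =
        (∫ t in (n : ℝ)..(n + s), u t) - ∫ t in (0 : ℝ)..s, u t := by
      rw [intervalIntegral.integral_comp_add_right, zero_add]
      have h1 := intervalIntegral.integral_add_adjacent_intervals (hi 0 s) (hi s (n + s))
      have h2 := intervalIntegral.integral_add_adjacent_intervals (hi 0 n) (hi n (n + s))
      linarith
    have h1 := abs_integral_le_of_bounded hC n (n + s)
    have h2 := abs_integral_le_of_bounded hC 0 s
    rw [add_sub_cancel_left] at h1
    rw [sub_zero] at h2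
    rw [cesaro, cesaro, ← mul_sub, e, norm_mul, norm_inv, Real.norm_natCast, mul_comm]
    gcongr
    calc _ ≤ |∫ t in (n : ℝ)..(n + s), u t| + |∫ t in (0 : ℝ)..s, u t| := abs_sub _ _
      _ ≤ _ := by linarith
  refine squeeze_zero_norm hb ?_
  simpa using (tendsto_inv_atTop_nhds_zero_nat (𝕜 := ℝ)).const_mul (2 * C * |s|)

theorem cesaroLimsup_shift {u : ℝ → ℝ} (hu : Measurable u) {C : ℝ} (hC : ∀ t, |u t| ≤ C)
    (s : ℝ) : cesaroLimsup (fun t => u (t + s)) = cesaroLimsup u := by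
  have h1 : ∀ n : ℕ, |cesaro (fun t => u (t + s)) n| ≤ C :=
    fun n => abs_cesaro_le (fun t => hC _) n
  have h2 : ∀ n : ℕ, |cesaro u n| ≤ C := fun n => abs_cesaro_le hC n
  have h := tendsto_cesaro_shift_sub hu hC s
  refine le_antisymm (limsup_le_of_tendsto_sub h1 h2 h) (limsup_le_of_tendsto_sub h2 h1 ?_)
  simpa using h.neg

/-- Rounding `T` down to an integer drops a piece of length at most one and changes the
normalization by the factor `⌊T⌋₊ / T → 1`. -/
theorem tendsto_cesaro_of_nat {u : ℝ → ℝ} (hu : Measurable u) {C : ℝ} (hC : ∀ t, |u t| ≤ C)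
    {L : ℝ} (h : Tendsto (fun n : ℕ => cesaro u n) atTop (𝓝 L)) :
    Tendsto (cesaro u) atTop (𝓝 L) := by
  have hi := intervalIntegrable_of_bounded hu hC
  have h0 : 0 ≤ C := (abs_nonneg _).trans (hC 0)
  have hfl : Tendsto (fun T : ℝ => (⌊T⌋₊ : ℝ) / T * cesaro u (⌊T⌋₊ : ℕ)) atTop (𝓝 (1 * L)) :=
    (tendsto_nat_floor_div_atTop).mul (h.comp tendsto_nat_floor_atTop)
  rw [one_mul] at hfl
  have hd : Tendsto (fun T : ℝ => cesaro u T - (⌊T⌋₊ : ℝ) / T * cesaro u (⌊T⌋₊ : ℕ)) atTop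
      (𝓝 0) := by
    refine squeeze_zero_norm' (a := fun T : ℝ => C * T⁻¹) ?_ ?_
    · filter_upwards [eventually_ge_atTop 1] with T hT
      have hT0 : 0 < T := by linarith
      have hfl0 : (0 : ℝ) < ⌊T⌋₊ := by exact_mod_cast Nat.floor_pos.2 hT
      have e : cesaro u T - (⌊T⌋₊ : ℝ) / T * cesaro u (⌊T⌋₊ : ℕ) =
          T⁻¹ * ∫ t in (⌊T⌋₊ : ℝ)..T, u t := by
        have h1 := intervalIntegral.integral_add_adjacent_intervals (hi 0 ⌊T⌋₊) (hi ⌊T⌋₊ T)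
        rw [cesaro, cesaro, ← h1]
        field_simp
        ring
      rw [e, norm_mul, norm_inv, Real.norm_of_nonneg hT0.le, mul_comm]
      gcongr
      refine (abs_integral_le_of_bounded hC _ _).trans ?_
      have h2 : |T - ⌊T⌋₊| ≤ 1 := by
        rw [abs_le]
        constructor <;> linarith [Nat.floor_le hT0.le, Nat.lt_floor_add_one T]
      simpa using mul_le_mul_of_nonneg_left h2 h0
    · simpa using tendsto_inv_atTop_zero.const_mul C
  simpa using hd.add hfl

/-! ### The maximal ergodic inequality -/

section Maximal

variable {X : Type*}

/-- The maximum of the Birkhoff sums `0, f, …, f + f ∘ T + ⋯ + f ∘ T^(N-1)`. -/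
def birkhoffMax (T : X → X) (f : X → ℝ) : ℕ → X → ℝ
  | 0 => fun _ => 0
  | N + 1 => fun x => max 0 (f x + birkhoffMax T f N (T x))

theorem birkhoffMax_nonneg (T : X → X) (f : X → ℝ) (N : ℕ) (x : X) : 0 ≤ birkhoffMax T f N x := by
  cases N with
  | zero => exact le_rfl
  | succ N => exact le_max_left _ _

theorem birkhoffMax_le_succ (T : X → X) (f : X → ℝ) (N : ℕ) (x : X) :
    birkhoffMax T f N x ≤ birkhoffMax T f (N + 1) x := by
  induction N generalizing x with
  | zero => exact birkhoffMax_nonneg T f 1 x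
  | succ N ih => exact max_le_max le_rfl (by linarith [ih (T x)])

theorem birkhoffSum_le_birkhoffMax (T : X → X) (f : X → ℝ) (N : ℕ) (x : X) :
    birkhoffSum T f N x ≤ birkhoffMax T f N x := by
  induction N generalizing x with
  | zero => simp [birkhoffMax]
  | succ N ih =>
    rw [birkhoffSum_succ']
    exact (by linarith [ih (T x)] : _ ≤ f x + birkhoffMax T f N (T x)).trans (le_max_right _ _)

variable [MeasurableSpace X]

theorem integrable_birkhoffMax {P : Measure X} {T : X → X} (hT : MeasurePreserving T P P)
    {f : X → ℝ} (hf : Integrable f P) (N : ℕ) : Integrable (birkhoffMax T f N) P := by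
  induction N with
  | zero => exact integrable_zero _ _ _
  | succ N ih => exact (integrable_zero _ _ _).sup (hf.add (hT.integrable_comp_of_integrable ih))

theorem measurable_birkhoffMax {T : X → X} (hT : Measurable T) {f : X → ℝ} (hf : Measurable f)
    (N : ℕ) : Measurable (birkhoffMax T f N) := by
  induction N with
  | zero => exact measurable_const
  | succ N ih => exact measurable_const.max (hf.add (ih.comp hT))

/-- The maximal ergodic inequality. -/
theorem integral_nonneg_of_birkhoffSum_pos {P : Measure X} {T : X → X}
    (hT : MeasurePreserving T P P) {f : X → ℝ} (hfm : Measurable f) (hf : Integrable f P)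
    (h : ∀ᵐ x ∂P, ∃ n, 0 < birkhoffSum T f n x) : 0 ≤ ∫ x, f x ∂P := by
  set A : ℕ → Set X := fun N => {x | 0 < birkhoffMax T f N x}
  have hA : ∀ N, MeasurableSet (A N) := fun N =>
    measurableSet_lt measurable_const (measurable_birkhoffMax hT.measurable hfm N)
  have hmono : Monotone A := monotone_nat_of_le_succ fun N x hx =>
    lt_of_lt_of_le hx (birkhoffMax_le_succ T f N x)
  have hN : ∀ N, 0 ≤ ∫ x in A N, f x ∂P := by
    intro N
    have hM := integrable_birkhoffMax hT hf N
    have hMT := hT.integrable_comp_of_integrable hM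
    have h0 : ∫ x, (birkhoffMax T f N x - birkhoffMax T f N (T x)) ∂P = 0 := by
      rw [integral_sub hM (show Integrable (fun x => birkhoffMax T f N (T x)) P from hMT),
        sub_eq_zero]
      have := hT.map_eq
      conv_lhs => rw [← this]
      rw [integral_map hT.measurable.aemeasurable
        (measurable_birkhoffMax hT.measurable hfm N).aestronglyMeasurable]
    rw [← integral_indicator (hA N), ← h0]
    -- Garsia's inequality: with `M` the maximum, `M - M ∘ T` is at most `f` where `M > 0`.
    -- Elsewhere `M = 0`, and the difference is at most `0` because `M ∘ T ≥ 0`.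
    refine integral_mono (hM.sub hMT) (hf.indicator (hA N)) fun x => ?_
    by_cases hx : x ∈ A N
    · rw [indicator_of_mem hx]
      cases N with
      | zero => exact absurd (show (0 : ℝ) < 0 from hx) (lt_irrefl _)
      | succ N =>
        have h1 := birkhoffMax_le_succ T f N (T x)
        have h2 : birkhoffMax T f (N + 1) x = f x + birkhoffMax T f N (T x) := by
          have hx' : 0 < max 0 (f x + birkhoffMax T f N (T x)) := hx
          exact max_eq_right ((lt_max_iff.1 hx').resolve_left (lt_irrefl _)).le
        simp only [h2]
        linarith
    · rw [indicator_of_notMem hx]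
      have := birkhoffMax_nonneg T f N (T x)
      have h2 : birkhoffMax T f N x ≤ 0 := not_lt.1 hx
      simp only
      linarith
  have hlim := tendsto_setIntegral_of_monotone hA hmono hf.integrableOn
  have hun : (⋃ N, A N) =ᵐ[P] univ := by
    rw [eventuallyEq_univ]
    filter_upwards [h] with x ⟨n, hn⟩
    exact mem_iUnion.2 ⟨n, hn.trans_le (birkhoffSum_le_birkhoffMax T f n x)⟩
  rw [setIntegral_congr_set hun, setIntegral_univ] at hlim
  exact ge_of_tendsto' hlim hN

end Maximal

/-! ### The pointwise ergodic theorem for flows -/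

section Flow

variable {X : Type*} [MeasurableSpace X]

/-- A jointly measurable action of `ℝ`. -/
structure IsMeasurableFlow (S : ℝ → X → X) : Prop where
  measurable_uncurry : Measurable (Function.uncurry S)
  map_add : ∀ s t x, S (s + t) x = S s (S t x)
  map_zero : ∀ x, S 0 x = x

/-- The sigma-algebra of invariant measurable sets. -/
abbrev flowInvariants (S : ℝ → X → X) : MeasurableSpace X :=
  ⨅ t : ℝ, MeasurableSpace.invariants (S t)

theorem measurableSet_flowInvariants {S : ℝ → X → X} {A : Set X} :
    MeasurableSet[flowInvariants S] A ↔ MeasurableSet A ∧ ∀ t, S t ⁻¹' A = A := by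
  rw [flowInvariants, MeasurableSpace.measurableSet_iInf]
  simp only [MeasurableSpace.measurableSet_invariants]
  exact ⟨fun h => ⟨(h 0).1, fun t => (h t).2⟩, fun h t => ⟨h.1, h.2 t⟩⟩

theorem flowInvariants_le (S : ℝ → X → X) : flowInvariants S ≤ ‹MeasurableSpace X› :=
  fun _ h => (measurableSet_flowInvariants.1 h).1

theorem flow_eq_of_measurable_invariants {S : ℝ → X → X} {β : Type*} [MeasurableSpace β]
    [MeasurableSingletonClass β] {c : X → β} (hc : Measurable[flowInvariants S] c) (t : ℝ) (x : X) :
    c (S t x) = c x := by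
  have h := (measurableSet_flowInvariants.1 (hc (measurableSet_singleton (c x)))).2 t
  have : x ∈ S t ⁻¹' (c ⁻¹' {c x}) := by rw [h]; rfl
  exact this

variable {S : ℝ → X → X}

theorem IsMeasurableFlow.measurable (hS : IsMeasurableFlow S) (t : ℝ) : Measurable (S t) :=
  hS.measurable_uncurry.comp measurable_prodMk_left

theorem IsMeasurableFlow.measurable_orbit (hS : IsMeasurableFlow S) (x : X) :
    Measurable fun t => S t x :=
  hS.measurable_uncurry.comp measurable_prodMk_right

theorem IsMeasurableFlow.iterate (hS : IsMeasurableFlow S) (k : ℕ) (x : X) :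
    (S 1)^[k] x = S k x := by
  induction k with
  | zero => simp [hS.map_zero]
  | succ k ih =>
    rw [Function.iterate_succ_apply', ih, ← hS.map_add]
    push_cast
    rw [add_comm]

theorem measurable_intervalIntegral_left {A : Type*} [MeasurableSpace A] {f : A → ℝ → ℝ}
    (hf : Measurable (Function.uncurry f)) (a b : ℝ) :
    Measurable fun x => ∫ t in a..b, f x t := by
  simp only [intervalIntegral]
  exact (hf.stronglyMeasurable.integral_prod_right.measurable).sub
    (hf.stronglyMeasurable.integral_prod_right.measurable)

theorem measurable_cesaro {A : Type*} [MeasurableSpace A] {f : A → ℝ → ℝ}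
    (hf : Measurable (Function.uncurry f)) (T : ℝ) : Measurable fun x => cesaro (f x) T :=
  (measurable_intervalIntegral_left hf 0 T).const_mul _

theorem measurable_cesaroLimsup {A : Type*} [MeasurableSpace A] {f : A → ℝ → ℝ}
    (hf : Measurable (Function.uncurry f)) : Measurable fun x => cesaroLimsup (f x) :=
  Measurable.limsup fun n => measurable_cesaro hf n

theorem measurable_orbit_uncurry (hS : IsMeasurableFlow S) {f : X → ℝ} (hf : Measurable f) :
    Measurable (Function.uncurry fun x t => f (S t x)) :=
  hf.comp (hS.measurable_uncurry.comp measurable_swap)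

/-- Integrating over unit time reduces averages along the flow to Birkhoff sums of the time-one map,
to which the maximal inequality applies. -/
theorem birkhoffSum_integral_flow (hS : IsMeasurableFlow S) {f : X → ℝ} (hf : Measurable f) {C : ℝ}
    (hC : ∀ x, |f x| ≤ C) (n : ℕ) (x : X) :
    birkhoffSum (S 1) (fun x => ∫ t in (0 : ℝ)..1, f (S t x)) n x =
      ∫ t in (0 : ℝ)..n, f (S t x) := by
  have hi := intervalIntegrable_of_bounded (hf.comp (hS.measurable_orbit x)) (fun t => hC (S t x))
  have h := intervalIntegral.sum_integral_adjacent_intervals (a := fun k : ℕ => (k : ℝ)) (n := n)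
    (fun k _ => hi k (k + 1 : ℕ))
  rw [Nat.cast_zero] at h
  refine Eq.trans ?_ h
  refine Finset.sum_congr rfl fun k _ => ?_
  simp only [hS.iterate, ← hS.map_add, Function.comp_def]
  rw [intervalIntegral.integral_comp_add_right (fun t => f (S t x))]
  push_cast
  rw [zero_add, add_comm]

theorem setIntegral_comp_flow {P : Measure X} (hP : ∀ t, MeasurePreserving (S t) P P) {E : Set X}
    (hE : MeasurableSet[flowInvariants S] E) {f : X → ℝ} (hf : Measurable f) (t : ℝ) :
    ∫ x in E, f (S t x) ∂P = ∫ x in E, f x ∂P := by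
  obtain ⟨hE1, hE2⟩ := measurableSet_flowInvariants.1 hE
  have h := (hP t).restrict_preimage hE1
  rw [hE2 t] at h
  conv_rhs => rw [← h.map_eq]
  rw [integral_map h.measurable.aemeasurable hf.aestronglyMeasurable]

theorem setIntegral_integral_flow {P : Measure X} [IsFiniteMeasure P] (hS : IsMeasurableFlow S)
    {E : Set X} {f : X → ℝ} (hf : Measurable f) {C : ℝ} (hC : ∀ x, |f x| ≤ C) (T : ℝ) :
    ∫ x in E, (∫ t in (0 : ℝ)..T, f (S t x)) ∂P = ∫ t in (0 : ℝ)..T, ∫ x in E, f (S t x) ∂P := by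
  symm
  refine intervalIntegral_integral_swap (f := fun t x => f (S t x)) ?_
  have : IsFiniteMeasure ((volume.restrict (uIoc 0 T)).prod (P.restrict E)) := by
    rw [uIoc]
    infer_instance
  refine Integrable.mono' (integrable_const C)
    (hf.comp hS.measurable_uncurry).aestronglyMeasurable ?_
  exact Eventually.of_forall fun p => hC _

/-- The set `E` where the upper limit exceeds `c + ε` is invariant. On it some Birkhoff sum of `F -
(c + ε)` is positive, `F` being the unit-time integral of `f`. The maximal inequality on `E` gives a
nonnegative integral, yet `F`, `f` and `c` have the same integral over `E`, so that integral is `-ε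
P(E)` and `E` is null. -/
theorem cesaroLimsup_le_ae {P : Measure X} [IsFiniteMeasure P] (hS : IsMeasurableFlow S)
    (hP : ∀ t, MeasurePreserving (S t) P P) {f c : X → ℝ} (hf : Measurable f) {C : ℝ}
    (hC : ∀ x, |f x| ≤ C) (hc : Measurable[flowInvariants S] c) (hcC : ∀ x, |c x| ≤ C)
    (hfc : ∀ E, MeasurableSet[flowInvariants S] E → ∫ x in E, c x ∂P = ∫ x in E, f x ∂P) :
    ∀ᵐ x ∂P, cesaroLimsup (fun t => f (S t x)) ≤ c x := by
  have hcm : Measurable c := hc.mono (flowInvariants_le S) le_rfl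
  have hHm : Measurable fun x => cesaroLimsup (fun t => f (S t x)) :=
    measurable_cesaroLimsup (measurable_orbit_uncurry hS hf)
  have key : ∀ ε : ℝ, 0 < ε → P {x | c x + ε < cesaroLimsup (fun t => f (S t x))} = 0 := by
    intro ε hε
    set E := {x | c x + ε < cesaroLimsup (fun t => f (S t x))}
    have hEm : MeasurableSet E := measurableSet_lt (hcm.add_const ε) hHm
    have hE : MeasurableSet[flowInvariants S] E := by
      refine measurableSet_flowInvariants.2 ⟨hEm, fun s => ?_⟩
      ext x
      simp only [E, mem_preimage, mem_ofPred_eq, flow_eq_of_measurable_invariants hc, ← hS.map_add]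
      have h := cesaroLimsup_shift (hf.comp (hS.measurable_orbit x)) (fun t => hC (S t x)) s
      simp only [Function.comp_apply] at h
      rw [h]
      rfl
    set F : X → ℝ := fun x => ∫ t in (0 : ℝ)..1, f (S t x)
    have hFm : Measurable F := measurable_intervalIntegral_left (measurable_orbit_uncurry hS hf) 0 1
    have hFC : ∀ x, |F x| ≤ C := fun x => by
      simpa using abs_integral_le_of_bounded (fun t => hC (S t x)) 0 1
    have hFi : Integrable F (P.restrict E) := Integrable.of_bound hFm.aestronglyMeasurable C
      (Eventually.of_forall hFC)
    have hci : Integrable c (P.restrict E) := Integrable.of_bound hcm.aestronglyMeasurable C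
      (Eventually.of_forall hcC)
    have hgi : Integrable (fun x => F x - (c x + ε)) (P.restrict E) :=
      hFi.sub (hci.add (integrable_const ε))
    have hT : MeasurePreserving (S 1) (P.restrict E) (P.restrict E) := by
      have h := (hP 1).restrict_preimage hEm
      rwa [(measurableSet_flowInvariants.1 hE).2 1] at h
    have hpos := integral_nonneg_of_birkhoffSum_pos hT (hFm.sub (hcm.add_const ε)) hgi (by
      refine ae_restrict_of_forall_mem hEm fun x hx => ?_
      have h1 := frequently_lt_of_lt_limsup (isCoboundedUnder_le_of_abs_le
        (fun n : ℕ => abs_cesaro_le (fun t => hC (S t x)) n)) hx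
      obtain ⟨n, hn, hn1⟩ := (h1.and_eventually (eventually_ge_atTop 1)).exists
      refine ⟨n, ?_⟩
      have hn0 : (0 : ℝ) < n := by exact_mod_cast hn1
      have h2 : birkhoffSum (S 1) (F - fun x => c x + ε) n x =
          (∫ t in (0 : ℝ)..n, f (S t x)) - n * (c x + ε) := by
        rw [birkhoffSum_sub, birkhoffSum_integral_flow hS hf hC]
        congr 1
        simp [birkhoffSum, hS.iterate, flow_eq_of_measurable_invariants hc, mul_add]
      rw [h2, sub_pos]
      rw [cesaro, inv_mul_eq_div, lt_div_iff₀ hn0] at hn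
      linarith)
    have hval : ∫ x in E, (F - fun x => c x + ε) x ∂P = -(ε * P.real E) := by
      have e1 : ∫ x in E, F x ∂P = ∫ x in E, f x ∂P := by
        rw [setIntegral_integral_flow hS hf hC]
        simp [setIntegral_comp_flow hP hE hf]
      simp only [Pi.sub_apply]
      have hce : Integrable (fun x => c x + ε) (P.restrict E) := hci.add (integrable_const ε)
      rw [integral_sub hFi hce, integral_add hci (integrable_const ε), e1, hfc E hE]
      simp [mul_comm]
    rw [hval] at hpos
    have h0 : P.real E = 0 := by
      have := measureReal_nonneg (μ := P) (s := E)
      nlinarith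
    exact (measureReal_eq_zero_iff).1 h0
  have hall : ∀ k : ℕ, ∀ᵐ x ∂P, cesaroLimsup (fun t => f (S t x)) ≤ c x + 1 / (k + 1) := by
    intro k
    have := key (1 / ((k : ℝ) + 1)) (by positivity)
    rw [ae_iff]
    simpa using this
  filter_upwards [ae_all_iff.2 hall] with x hx
  have h := tendsto_one_div_add_atTop_nhds_zero_nat (𝕜 := ℝ)
  simpa using ge_of_tendsto' (h.const_add (c x)) hx

/-- The pointwise ergodic theorem. -/
theorem tendsto_cesaro_flow {P : Measure X} [IsFiniteMeasure P] (hS : IsMeasurableFlow S)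
    (hP : ∀ t, MeasurePreserving (S t) P P) {f c : X → ℝ} (hf : Measurable f) {C : ℝ}
    (hC : ∀ x, |f x| ≤ C) (hc : Measurable[flowInvariants S] c) (hcC : ∀ x, |c x| ≤ C)
    (hfc : ∀ E, MeasurableSet[flowInvariants S] E → ∫ x in E, c x ∂P = ∫ x in E, f x ∂P) :
    ∀ᵐ x ∂P, Tendsto (fun n : ℕ => cesaro (fun t => f (S t x)) n) atTop (𝓝 (c x)) := by
  have h1 := cesaroLimsup_le_ae hS hP hf hC hc hcC hfc
  -- The bound for `-f` controls the lower limit.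
  have h2 := cesaroLimsup_le_ae (f := fun x => -f x) (c := fun x => -c x) hS hP hf.neg
    (C := C) (by simpa using hC) (@Measurable.neg _ _ _ _ _ (flowInvariants S) _ hc)
    (by simpa using hcC)
    (fun E hE => by simp only [integral_neg, hfc E hE])
  filter_upwards [h1, h2] with x h1 h2
  have hb : ∀ n : ℕ, |cesaro (fun t => f (S t x)) n| ≤ C :=
    fun n => abs_cesaro_le (fun t => hC (S t x)) n
  have hb' : ∀ n : ℕ, |cesaro (fun t => -f (S t x)) n| ≤ C :=
    fun n => abs_cesaro_le (fun t => by simpa using hC (S t x)) n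
  rw [tendsto_order]
  constructor
  · intro a ha
    have := eventually_lt_of_limsup_lt (h2.trans_lt (neg_lt_neg ha))
      (isBoundedUnder_le_of_abs_le hb')
    filter_upwards [this] with n hn
    simpa [cesaro] using hn
  · intro a ha
    exact eventually_lt_of_limsup_lt (h1.trans_lt ha) (isBoundedUnder_le_of_abs_le hb)

end Flow

/-! ### Disintegration over the invariant sets -/

section Disintegration

variable {X : Type*} [MeasurableSpace X] {S : ℝ → X → X} {P : ProbabilityMeasure X}
  {κ : X → ProbabilityMeasure X}

/-- `κ` is a disintegration of `P` over the sigma-algebra of invariant sets. -/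
structure IsInvariantDisintegration (S : ℝ → X → X) (P : ProbabilityMeasure X)
    (κ : X → ProbabilityMeasure X) : Prop where
  measurable : Measurable[flowInvariants S] κ
  setLIntegral : ∀ A, MeasurableSet[flowInvariants S] A → ∀ B, MeasurableSet B →
    ∫⁻ x in A, (κ x : Measure X) B ∂(P : Measure X) = (P : Measure X) (A ∩ B)

theorem measurable_kernel_of_invariants (hκ : Measurable[flowInvariants S] κ) :
    Measurable fun x => (κ x : Measure X) :=
  measurable_subtype_coe.comp (hκ.mono (flowInvariants_le S) le_rfl)

/-- Being carried by both `A` and `Aᶜ` forces `κ x A` to be the indicator of `A` almost everywhere.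
Then `κ x (A ∩ B)` is that indicator times `κ x B`, and the barycenter identity for `A ∩ B` is the
claim. -/
theorem isInvariantDisintegration_of_carried (hκ : Measurable[flowInvariants S] κ)
    (hb : (P : Measure X).bind (fun x => (κ x : Measure X)) = P)
    (hc : ∀ A, MeasurableSet[flowInvariants S] A →
      ∀ᵐ x ∂(P : Measure X), x ∈ A → (κ x : Measure X) A = 1) :
    IsInvariantDisintegration S P κ := by
  refine ⟨hκ, fun A hA B hB => ?_⟩
  have hAm := flowInvariants_le S A hA
  have hm := measurable_kernel_of_invariants hκ
  have h1 := hc A hA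
  have h2 := hc Aᶜ (MeasurableSet.compl (m := flowInvariants S) hA)
  have hPB : (P : Measure X) (A ∩ B) =
      ((P : Measure X).bind (fun x => (κ x : Measure X))) (B ∩ A) := by rw [hb, inter_comm]
  rw [hPB, Measure.bind_apply (hB.inter hAm) hm.aemeasurable, ← lintegral_indicator hAm]
  refine lintegral_congr_ae ?_
  filter_upwards [h1, h2] with x h1 h2
  by_cases hx : x ∈ A
  · rw [indicator_of_mem hx]
    rw [inter_comm]
    exact (Measure.measure_inter_eq_of_ae ((mem_ae_iff_prob_eq_one hAm).2 (h1 hx))).symm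
  · rw [indicator_of_notMem hx]
    have h0 : (κ x : Measure X) A = 0 := by
      rw [← prob_compl_eq_one_iff hAm]
      exact h2 hx
    exact (measure_mono_null inter_subset_right h0).symm

namespace IsInvariantDisintegration

variable (h : IsInvariantDisintegration S P κ)
include h

theorem bind_restrict {E : Set X} (hE : MeasurableSet[flowInvariants S] E) :
    ((P : Measure X).restrict E).bind (fun x => (κ x : Measure X)) =
      (P : Measure X).restrict E := by
  ext B hB
  rw [Measure.bind_apply hB (measurable_kernel_of_invariants h.measurable).aemeasurable,
    h.setLIntegral E hE B hB, Measure.restrict_apply hB, inter_comm]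

theorem bind_eq : (P : Measure X).bind (fun x => (κ x : Measure X)) = P := by
  simpa using h.bind_restrict (MeasurableSet.univ (m := flowInvariants S))

theorem ae_ae {p : X → Prop} (hp : ∀ᵐ x ∂(P : Measure X), p x) :
    ∀ᵐ x ∂(P : Measure X), ∀ᵐ y ∂(κ x : Measure X), p y := by
  refine Measure.ae_ae_of_ae_bind (measurable_kernel_of_invariants h.measurable).aemeasurable ?_
  rwa [h.bind_eq]

theorem carried {A : Set X} (hA : MeasurableSet[flowInvariants S] A) :
    ∀ᵐ x ∂(P : Measure X), x ∈ A → (κ x : Measure X) A = 1 := by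
  have hAm := flowInvariants_le S A hA
  have h0 : ∫⁻ x in A, (κ x : Measure X) Aᶜ ∂(P : Measure X) = 0 := by
    rw [h.setLIntegral A hA _ hAm.compl, inter_compl_self, measure_empty]
  have hm : Measurable fun x => (κ x : Measure X) Aᶜ :=
    (Measure.measurable_coe hAm.compl).comp (measurable_kernel_of_invariants h.measurable)
  rw [lintegral_eq_zero_iff hm] at h0
  have h1 := (ae_restrict_iff' hAm).1 h0
  filter_upwards [h1] with x hx hxA
  exact (prob_compl_eq_zero_iff hAm).1 (hx hxA)

theorem measurable_integral {f : X → ℝ} (hf : Measurable f) :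
    Measurable[flowInvariants S] fun x => ∫ y, f y ∂(κ x : Measure X) := by
  let K : @ProbabilityTheory.Kernel X X (flowInvariants S) _ :=
    @ProbabilityTheory.Kernel.mk X X (flowInvariants S) _ (fun x => (κ x : Measure X))
      (measurable_subtype_coe.comp h.measurable)
  exact (StronglyMeasurable.integral_kernel (κ := K) hf.stronglyMeasurable).measurable

theorem setIntegral {f : X → ℝ} (hf : Measurable f) {C : ℝ} (hC : ∀ x, |f x| ≤ C) {E : Set X}
    (hE : MeasurableSet[flowInvariants S] E) :
    ∫ x in E, (∫ y, f y ∂(κ x : Measure X)) ∂(P : Measure X) = ∫ x in E, f x ∂(P : Measure X) := by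
  let K : ProbabilityTheory.Kernel X X :=
    ⟨fun x => (κ x : Measure X), measurable_kernel_of_invariants h.measurable⟩
  have e : (K.comp (ProbabilityTheory.Kernel.const Unit ((P : Measure X).restrict E))) () =
      (P : Measure X).restrict E := by
    rw [ProbabilityTheory.Kernel.comp_apply]
    exact h.bind_restrict hE
  have := ProbabilityTheory.Kernel.integral_comp (η := K)
    (κ := ProbabilityTheory.Kernel.const Unit ((P : Measure X).restrict E)) (a := ()) (f := f) (by
      rw [e]
      exact Integrable.of_bound hf.aestronglyMeasurable C (Eventually.of_forall hC))
  rw [e] at this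
  exact this.symm

/-- The integral of `f` against `κ x` is an invariant function with the integrals of `f` over
invariant sets, hence the limit in the ergodic theorem. -/
theorem tendsto_cesaro (hS : IsMeasurableFlow S)
    (hP : ∀ t, MeasurePreserving (S t) (P : Measure X) P) {f : X → ℝ} (hf : Measurable f) {C : ℝ}
    (hC : ∀ x, |f x| ≤ C) :
    ∀ᵐ x ∂(P : Measure X), Tendsto (fun n : ℕ => cesaro (fun t => f (S t x)) n) atTop
      (𝓝 (∫ y, f y ∂(κ x : Measure X))) := by
  refine tendsto_cesaro_flow hS hP hf hC (h.measurable_integral hf) (fun x => ?_)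
    fun E hE => h.setIntegral hf hC hE
  simpa using norm_integral_le_of_norm_le_const (μ := (κ x : Measure X)) (f := f)
    (Eventually.of_forall hC)

/-- Each sublevel set at a rational height, and its complement, is invariant and carries the
components of almost all its points. Countably many heights determine the value of `c`. -/
theorem ae_const {c : X → ℝ} (hc : Measurable[flowInvariants S] c) :
    ∀ᵐ x ∂(P : Measure X), ∀ᵐ y ∂(κ x : Measure X), c y = c x := by
  have hq : ∀ q : ℚ, ∀ᵐ x ∂(P : Measure X), ∀ᵐ y ∂(κ x : Measure X), (c y < q ↔ c x < q) := by
    intro q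
    have hA : MeasurableSet[flowInvariants S] {x | c x < q} := hc measurableSet_Iio
    have hA' := MeasurableSet.compl (m := flowInvariants S) hA
    filter_upwards [h.carried hA, h.carried hA'] with x h1 h2
    by_cases hx : c x < q
    · filter_upwards [(mem_ae_iff_prob_eq_one (flowInvariants_le S _ hA)).2 (h1 hx)] with y hy
      exact iff_of_true hy hx
    · filter_upwards [(mem_ae_iff_prob_eq_one (flowInvariants_le S _ hA')).2 (h2 hx)] with y hy
      exact iff_of_false hy hx
  filter_upwards [ae_all_iff.2 hq] with x hx
  filter_upwards [ae_all_iff.2 hx] with y hy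
  refine le_antisymm (le_of_not_gt fun hlt => ?_) (le_of_not_gt fun hlt => ?_)
  · obtain ⟨q, h1, h2⟩ := exists_rat_btwn hlt
    exact absurd ((hy q).2 h1) (not_lt.2 h2.le)
  · obtain ⟨q, h1, h2⟩ := exists_rat_btwn hlt
    exact absurd ((hy q).1 h1) (not_lt.2 h2.le)

/-- Both sides are invariant functions of `x` with the same integral over each invariant `E`, since
`S t` preserves `P` and fixes `E`. -/
theorem ae_map_apply_eq (hP : ∀ t, MeasurePreserving (S t) (P : Measure X) P) (t : ℝ) {B : Set X}
    (hB : MeasurableSet B) :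
    ∀ᵐ x ∂(P : Measure X), (κ x : Measure X) (S t ⁻¹' B) = (κ x : Measure X) B := by
  have hBt := (hP t).measurable hB
  have hmeas : ∀ B, MeasurableSet B →
      Measurable[flowInvariants S] fun x => (κ x : Measure X).real B := fun B hB =>
    (((Measure.measurable_coe hB).comp measurable_subtype_coe).comp h.measurable).ennreal_toReal
  have hint : ∀ B, MeasurableSet B → Integrable (fun x => (κ x : Measure X).real B)
      (P : Measure X) := fun B hB =>
    Integrable.of_bound ((hmeas B hB).mono (flowInvariants_le S) le_rfl).aestronglyMeasurable 1
      (Eventually.of_forall fun x => by simp)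
  have hset : ∀ E, MeasurableSet[flowInvariants S] E → ∀ B, MeasurableSet B →
      ∫ x in E, (κ x : Measure X).real B ∂(P : Measure X) = ((P : Measure X) (E ∩ B)).toReal := by
    intro E hE B hB
    rw [← h.setLIntegral E hE B hB]
    exact integral_toReal ((Measure.measurable_coe hB).comp
      (measurable_kernel_of_invariants h.measurable)).aemeasurable
      (Eventually.of_forall fun x => measure_lt_top _ _)
  have key := ae_eq_of_forall_setIntegral_eq_of_sigmaFinite' (μ := (P : Measure X))
    (flowInvariants_le S) (fun E _ _ => (hint _ hBt).integrableOn)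
    (fun E _ _ => (hint _ hB).integrableOn) (fun E hE _ => by
      rw [hset E hE _ hBt, hset E hE _ hB]
      obtain ⟨hE1, hE2⟩ := measurableSet_flowInvariants.1 hE
      rw [← (hP t).measure_preimage (hE1.inter hB).nullMeasurableSet, preimage_inter, hE2 t])
    (hmeas _ hBt).stronglyMeasurable.aestronglyMeasurable
    (hmeas _ hB).stronglyMeasurable.aestronglyMeasurable
  filter_upwards [key] with x hx
  exact (ENNReal.toReal_eq_toReal_iff' (measure_ne_top _ _) (measure_ne_top _ _)).1 hx

end IsInvariantDisintegration

/-! ### Invariance, ergodicity and existence of the components -/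

theorem exists_countable_piSystem (X : Type*) [m : MeasurableSpace X]
    [MeasurableSpace.CountablyGenerated X] :
    ∃ 𝒞 : Set (Set X), 𝒞.Countable ∧ IsPiSystem 𝒞 ∧ m = MeasurableSpace.generateFrom 𝒞 := by
  refine ⟨generateSetAlgebra (MeasurableSpace.countableGeneratingSet X),
    countable_generateSetAlgebra MeasurableSpace.countable_countableGeneratingSet,
    fun s hs t ht _ => isSetAlgebra_generateSetAlgebra.inter_mem hs ht,
    ?_⟩
  rw [generateFrom_generateSetAlgebra_eq, MeasurableSpace.generateFrom_countableGeneratingSet]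

/-- The good set and its reflection `t ↦ s - t` are both conull, so they meet. Hence a property of
times that is stable under addition and holds almost everywhere holds everywhere. -/
theorem exists_mem_sub_mem_of_ae {p : ℝ → Prop} (hp : ∀ᵐ t, p t) (s : ℝ) :
    ∃ t, p t ∧ p (s - t) := by
  have h2 : ∀ᵐ t, p (s - t) :=
    (Measure.measurePreserving_sub_left volume s).quasiMeasurePreserving.ae hp
  exact (hp.and h2).exists

/-- The exceptional null set of `ae_map_apply_eq` depends on the uncountable parameter `t`. Fubini
exchanges the quantifiers at the price of almost every `t` only. The times preserving `κ x` are
closed under addition, which recovers all of them. -/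
theorem IsInvariantDisintegration.ae_invariant [MeasurableSpace.CountablyGenerated X]
    (h : IsInvariantDisintegration S P κ) (hS : IsMeasurableFlow S)
    (hP : ∀ t, MeasurePreserving (S t) (P : Measure X) P) :
    ∀ᵐ x ∂(P : Measure X), ∀ t, MeasurePreserving (S t) (κ x : Measure X) (κ x) := by
  obtain ⟨𝒞, hcount, hpi, hgen⟩ := exists_countable_piSystem X
  have h𝒞 : ∀ B ∈ 𝒞, MeasurableSet B := fun B hB => by
    rw [hgen]; exact MeasurableSpace.measurableSet_generateFrom hB
  let K : ProbabilityTheory.Kernel X X :=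
    ⟨fun x => (κ x : Measure X), measurable_kernel_of_invariants h.measurable⟩
  have : ProbabilityTheory.IsMarkovKernel K := ⟨fun x => by
    change IsProbabilityMeasure (κ x : Measure X)
    infer_instance⟩
  have hae : ∀ B ∈ 𝒞, ∀ᵐ x ∂(P : Measure X), ∀ᵐ t : ℝ,
      (κ x : Measure X) (S t ⁻¹' B) = (κ x : Measure X) B := by
    intro B hB
    have hm : Measurable fun p : ℝ × X => (κ p.2 : Measure X) (S p.1 ⁻¹' B) :=
      ProbabilityTheory.Kernel.measurable_kernel_prodMk_left (κ := K.comap Prod.snd measurable_snd)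
        (t := {q : (ℝ × X) × X | S q.1.1 q.2 ∈ B})
        (hS.measurable_uncurry.comp (by fun_prop : Measurable fun q : (ℝ × X) × X => (q.1.1, q.2))
          (h𝒞 B hB))
    have hm' : Measurable fun p : ℝ × X => (κ p.2 : Measure X) B :=
      (K.measurable_coe (h𝒞 B hB)).comp measurable_snd
    have hset : MeasurableSet {p : ℝ × X |
        (κ p.2 : Measure X) (S p.1 ⁻¹' B) = (κ p.2 : Measure X) B} := measurableSet_eq_fun hm hm'
    refine (Measure.ae_ae_comm hset).1 ?_
    exact Eventually.of_forall fun t => h.ae_map_apply_eq hP t (h𝒞 B hB)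
  filter_upwards [(ae_ball_iff hcount).2 hae] with x hx
  have hx' := (ae_ball_iff hcount).2 hx
  have hG : ∀ᵐ t : ℝ, MeasurePreserving (S t) (κ x : Measure X) (κ x) := by
    filter_upwards [hx'] with t ht
    refine ⟨hS.measurable t, ?_⟩
    have := Measure.isProbabilityMeasure_map (μ := (κ x : Measure X)) (hS.measurable t).aemeasurable
    refine ext_of_generate_finite 𝒞 hgen hpi (fun B hB => ?_) (by simp)
    rw [Measure.map_apply (hS.measurable t) (h𝒞 B hB), ht B hB]
  intro s
  obtain ⟨t, ht1, ht2⟩ := exists_mem_sub_mem_of_ae hG s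
  have := ht2.comp ht1
  convert this using 1
  ext y
  rw [Function.comp_apply, ← hS.map_add, sub_add_cancel]

/-- Convergence of averages to constants on a generating `π`-system implies ergodicity. -/
theorem ergodic_of_tendsto_cesaro (hS : IsMeasurableFlow S) {Q : Measure X} [IsProbabilityMeasure Q]
    (hQ : ∀ t, MeasurePreserving (S t) Q Q) {𝒞 : Set (Set X)} (hpi : IsPiSystem 𝒞)
    (hgen : ‹MeasurableSpace X› = MeasurableSpace.generateFrom 𝒞)
    (hlim : ∀ B ∈ 𝒞, ∀ᵐ x ∂Q, Tendsto
      (fun n : ℕ => cesaro (fun t => B.indicator (fun _ => (1 : ℝ)) (S t x)) n) atTop (𝓝 (Q.real B)))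
    {A : Set X} (hA : MeasurableSet A) (hAS : ∀ t, Q (symmDiff (S t ⁻¹' A) A) = 0) :
    Q A = 0 ∨ Q A = 1 := by
  -- Averages of the indicator of `B`, integrated over the almost invariant set `A`, all equal `Q (B
  -- ∩ A)` and converge to `Q A * Q B`. So `A` is independent of a generating `π`-system, hence of
  -- itself.
  have hmul : ∀ B ∈ 𝒞, Q (B ∩ A) = Q A * Q B := by
    intro B hB
    have hBm : MeasurableSet B := by rw [hgen]; exact MeasurableSpace.measurableSet_generateFrom hB
    set f : X → ℝ := B.indicator fun _ => (1 : ℝ)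
    have hf : Measurable f := measurable_const.indicator hBm
    have hf1 : ∀ x, |f x| ≤ 1 := fun x => by
      by_cases hx : x ∈ B <;> simp [f, hx]
    have hAt : ∀ t, (∫ x in A, f (S t x) ∂Q) = Q.real (B ∩ A) := by
      intro t
      have hBt := (hQ t).measurable hBm
      have e1 : (fun x => f (S t x)) = (S t ⁻¹' B).indicator fun _ => (1 : ℝ) := by
        ext x; rfl
      rw [e1, setIntegral_indicator hBt, setIntegral_const, smul_eq_mul, mul_one, measureReal_def,
        measureReal_def, inter_comm]
      congr 1
      have hae : (A : Set X) =ᵐ[Q] (S t ⁻¹' A) := (measure_symmDiff_eq_zero_iff.1 (hAS t)).symm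
      rw [measure_congr (EventuallyEq.rfl.inter hae), ← preimage_inter,
        (hQ t).measure_preimage (hBm.inter hA).nullMeasurableSet]
    have h1 : Tendsto (fun n : ℕ => ∫ x in A, cesaro (fun t => f (S t x)) n ∂Q) atTop
        (𝓝 (∫ x in A, Q.real B ∂Q)) := by
      refine tendsto_integral_of_dominated_convergence (fun _ => 1)
        (fun n => (measurable_cesaro (measurable_orbit_uncurry hS hf) n).aestronglyMeasurable)
        (integrable_const _)
        (fun n => Eventually.of_forall fun x => abs_cesaro_le (fun t => hf1 (S t x)) n)
        (ae_restrict_of_ae (hlim B hB))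
    have h2 : ∀ᶠ n : ℕ in atTop, ∫ x in A, cesaro (fun t => f (S t x)) n ∂Q = Q.real (B ∩ A) := by
      filter_upwards [eventually_ge_atTop 1] with n hn
      have hn0 : (n : ℝ) ≠ 0 := by exact_mod_cast (Nat.pos_of_ne_zero (by omega)).ne'
      simp only [cesaro]
      rw [integral_const_mul, setIntegral_integral_flow hS hf hf1]
      simp only [hAt, intervalIntegral.integral_const, sub_zero, smul_eq_mul]
      field_simp
    have h3 := tendsto_nhds_unique (h1.congr' h2) tendsto_const_nhds
    rw [setIntegral_const, smul_eq_mul, measureReal_def, measureReal_def, measureReal_def,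
      ← ENNReal.toReal_mul] at h3
    exact ((ENNReal.toReal_eq_toReal_iff' (by finiteness) (by finiteness)).1 h3).symm
  have heq : Q.restrict A = Q A • Q := by
    refine ext_of_generate_finite 𝒞 hgen hpi (fun B hB => ?_) (by simp)
    have hBm : MeasurableSet B := by rw [hgen]; exact MeasurableSpace.measurableSet_generateFrom hB
    rw [Measure.restrict_apply hBm, hmul B hB, Measure.smul_apply, smul_eq_mul]
  have hself : Q A = Q A * Q A := by
    have := congrArg (fun m : Measure X => m A) heq
    simpa using this
  rcases eq_or_ne (Q A) 0 with h0 | h0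
  · exact Or.inl h0
  · right
    have := (ENNReal.mul_right_inj h0 (measure_ne_top Q A)).1 (show Q A * Q A = Q A * 1 by
      rw [mul_one]; exact hself.symm)
    exact this

/-- The ergodic theorem for `P` holds at `κ x`-almost every `y` with limit `κ y B`, and by
`ae_const` this is `κ x B`. A countable `π`-system makes the exceptional set uniform, so the
convergence criterion applies to `κ x`. -/
theorem IsInvariantDisintegration.ae_ergodic [MeasurableSpace.CountablyGenerated X]
    (h : IsInvariantDisintegration S P κ) (hS : IsMeasurableFlow S)
    (hP : ∀ t, MeasurePreserving (S t) (P : Measure X) P) :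
    ∀ᵐ x ∂(P : Measure X), ∀ A : Set X, MeasurableSet A →
      (∀ t : ℝ, (κ x : Measure X) (symmDiff (S t ⁻¹' A) A) = 0) →
        (κ x : Measure X) A = 0 ∨ (κ x : Measure X) A = 1 := by
  obtain ⟨𝒞, hcount, hpi, hgen⟩ := exists_countable_piSystem X
  have hlim : ∀ B ∈ 𝒞, ∀ᵐ x ∂(P : Measure X), ∀ᵐ y ∂(κ x : Measure X), Tendsto
      (fun n : ℕ => cesaro (fun t => B.indicator (fun _ => (1 : ℝ)) (S t y)) n) atTop
        (𝓝 ((κ x : Measure X).real B)) := by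
    intro B hB
    have hBm : MeasurableSet B := by rw [hgen]; exact MeasurableSpace.measurableSet_generateFrom hB
    have hf : Measurable (B.indicator fun _ => (1 : ℝ)) := measurable_const.indicator hBm
    have h1 := h.ae_ae (h.tendsto_cesaro hS hP hf (C := 1) fun x => by
      by_cases hx : x ∈ B <;> simp [hx])
    have h2 := h.ae_const (h.measurable_integral hf)
    filter_upwards [h1, h2] with x h1 h2
    filter_upwards [h1, h2] with y h1 h2
    rw [h2, integral_indicator hBm] at h1
    simpa using h1
  filter_upwards [(ae_ball_iff hcount).2 hlim, h.ae_invariant hS hP] with x h1 h2 A hA hAS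
  exact ergodic_of_tendsto_cesaro hS h2 hpi hgen h1 hA hAS

theorem exists_isInvariantDisintegration [StandardBorelSpace X] (S : ℝ → X → X)
    (P : ProbabilityMeasure X) : ∃ κ, IsInvariantDisintegration S P κ := by
  let K := ProbabilityTheory.condExpKernel (P : Measure X) (flowInvariants S)
  refine ⟨fun x => ⟨K x, inferInstance⟩, Measurable.subtype_mk K.measurable, fun A hA B hB => ?_⟩
  have hm := flowInvariants_le S
  -- The joint law of a point seen through the invariant sets and its conditional distribution is
  -- the diagonal image of `P`. On rectangles this is the disintegration identity.
  have e := ProbabilityTheory.compProd_trim_condExpKernel (μ := (P : Measure X)) hm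
  have e2 := DFunLike.congr_fun e (A ×ˢ B)
  rw [Measure.compProd_apply_prod hA hB, restrict_trim hm _ hA,
    lintegral_trim hm (K.measurable_coe hB)] at e2
  refine e2.trans ?_
  rw [@Measure.map_apply _ _ _ ((flowInvariants S).prod _) _ _ ?_ _ ?_]
  · rfl
  · exact @Measurable.prodMk _ _ _ _ (flowInvariants S) _ _ _ (measurable_id'' hm) measurable_id
  · exact @MeasurableSet.prod _ _ (flowInvariants S) _ _ _ hA hB

end Disintegration

/-! ### Joint measurability -/

section Measurability

variable {d : ℕ}

/-- A measurable family of measures that are finite on the pieces of a countable partition is an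
s-finite kernel. -/
theorem isSFiniteKernel_of_partition {α β : Type*} [MeasurableSpace α] [MeasurableSpace β]
    (K : ProbabilityTheory.Kernel α β) {A : ℕ → Set β} (hA : ∀ n, MeasurableSet (A n))
    (hdisj : Pairwise (Function.onFun Disjoint A)) (hun : ⋃ n, A n = univ)
    (hfin : ∀ a n, K a (A n) ≠ ⊤) : ProbabilityTheory.IsSFiniteKernel K := by
  classical
  have hset : ∀ n k, MeasurableSet {a | ⌊(K a (A n)).toReal⌋₊ = k} := fun n k =>
    (Nat.measurable_floor.comp (K.measurable_coe (hA n)).ennreal_toReal) (measurableSet_singleton k)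
  -- The piece indexed by `(n, k)` lives on `A n` and only over parameters whose mass on `A n` has
  -- integer part `k`, so its mass is at most `k + 1`.
  let L : ℕ × ℕ → ProbabilityTheory.Kernel α β := fun p =>
    ProbabilityTheory.Kernel.piecewise (hset p.1 p.2) (K.restrict (hA p.1)) 0
  have hL : ∀ p, ProbabilityTheory.IsFiniteKernel (L p) := by
    intro p
    refine ⟨ENNReal.ofReal (p.2 + 1), ENNReal.ofReal_lt_top, fun a => ?_⟩
    simp only [L, ProbabilityTheory.Kernel.piecewise_apply']
    split_ifs with h
    · rw [ProbabilityTheory.Kernel.restrict_apply, Measure.restrict_apply_univ,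
        ← ENNReal.ofReal_toReal (hfin a p.1)]
      refine ENNReal.ofReal_le_ofReal ?_
      rw [← show ⌊(K a (A p.1)).toReal⌋₊ = p.2 from h]
      exact (Nat.lt_floor_add_one _).le
    · simp
  have hsum : K = ProbabilityTheory.Kernel.sum L := by
    ext a s hs
    rw [ProbabilityTheory.Kernel.sum_apply' _ _ hs, ENNReal.tsum_prod']
    have h1 : ∀ n, ∑' k, L (n, k) a s = K a (s ∩ A n) := by
      intro n
      simp only [L, ProbabilityTheory.Kernel.piecewise_apply',
        ProbabilityTheory.Kernel.restrict_apply, Measure.restrict_apply hs, mem_ofPred_eq,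
        zero_apply, Measure.coe_zero, Pi.zero_apply]
      rw [tsum_eq_single ⌊(K a (A n)).toReal⌋₊ fun k hk => if_neg hk.symm, if_pos rfl]
    simp_rw [h1]
    rw [← measure_iUnion (fun i j hij => (hdisj hij).mono inter_subset_right inter_subset_right)
      (fun n => hs.inter (hA n)), ← inter_iUnion, hun, inter_univ]
  rw [hsum]
  infer_instance

/-- The successive differences of the closed balls of radius `e^n`. -/
def annulus (d n : ℕ) : Set (Fin d → ℝ) :=
  disjointed (fun n : ℕ => Metric.closedBall (0 : Fin d → ℝ) (Real.exp n)) n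

theorem annulus_subset (d n : ℕ) : annulus d n ⊆ Metric.closedBall 0 (Real.exp n) :=
  disjointed_subset _ n

theorem measurableSet_annulus (d n : ℕ) : MeasurableSet (annulus d n) :=
  MeasurableSet.disjointed (fun _ => Metric.isClosed_closedBall.measurableSet) n

theorem pairwise_disjoint_annulus (d : ℕ) : Pairwise (Function.onFun Disjoint (annulus d)) :=
  disjoint_disjointed _

theorem iUnion_closedBall_exp (d : ℕ) :
    ⋃ n : ℕ, Metric.closedBall (0 : Fin d → ℝ) (Real.exp n) = univ := by
  refine eq_univ_of_forall fun y => ?_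
  obtain ⟨n, hn⟩ := exists_nat_ge ‖y‖
  refine mem_iUnion.2 ⟨n, ?_⟩
  rw [mem_closedBall_zero_iff]
  linarith [Real.add_one_le_exp (n : ℝ)]

theorem iUnion_annulus (d : ℕ) : ⋃ n, annulus d n = univ := by
  rw [← iUnion_closedBall_exp d]
  exact iUnion_disjointed

theorem measure_closedBall_ne_top (μ : Measure (Fin d → ℝ)) [IsLocallyFiniteMeasure μ]
    (x : Fin d → ℝ) (r : ℝ) : μ (Metric.closedBall x r) ≠ ⊤ :=
  (isCompact_closedBall x r).measure_lt_top.ne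

/-- The tautological kernel. -/
def phaseKernel (d : ℕ) : ProbabilityTheory.Kernel (Phase d) (Fin d → ℝ) :=
  ⟨Subtype.val, measurable_subtype_coe⟩

/-- Radon measures have no common bound on a given ball, so the kernel is only s-finite. This
suffices for joint measurability of integrals depending on a measure and a parameter. -/
instance isSFiniteKernel_phaseKernel : ProbabilityTheory.IsSFiniteKernel (phaseKernel d) :=
  isSFiniteKernel_of_partition _ (measurableSet_annulus d) (pairwise_disjoint_annulus d)
    (iUnion_annulus d) fun μ n =>
      measure_ne_top_of_subset (annulus_subset d n) (measure_closedBall_ne_top μ.1 0 _)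

theorem measurable_map_phase {α β : Type*} [MeasurableSpace α] [MeasurableSpace β]
    {m : α → Phase d} (hm : Measurable m) {g : α → (Fin d → ℝ) → β}
    (hg : Measurable (Function.uncurry g)) : Measurable fun a => (m a).1.map (g a) := by
  refine Measure.measurable_of_measurable_coe _ fun s hs => ?_
  have hga : ∀ a, Measurable (g a) := fun a => hg.comp measurable_prodMk_left
  simp_rw [Measure.map_apply (hga _) hs]
  exact ProbabilityTheory.Kernel.measurable_kernel_prodMk_left (κ := (phaseKernel d).comap m hm)
    (hg hs)

theorem measurable_lintegral_phase {α : Type*} [MeasurableSpace α]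
    {m : α → Phase d} (hm : Measurable m) {g : α → (Fin d → ℝ) → ENNReal}
    (hg : Measurable (Function.uncurry g)) {A : Set (Fin d → ℝ)} (hA : MeasurableSet A) :
    Measurable fun a => ∫⁻ y in A, g a y ∂(m a).1 :=
  Measurable.setLIntegral_kernel_prod_right (κ := (phaseKernel d).comap m hm) hg hA

theorem measurable_normStar : Measurable (normStar : Measure (Fin d → ℝ) → Measure (Fin d → ℝ)) := by
  refine Measure.measurable_of_measurable_coe _ fun s hs => ?_
  simp_rw [normStar, Measure.smul_apply, smul_eq_mul]
  exact (Measure.measurable_coe (measurableSet_unitBall d)).inv.mul (Measure.measurable_coe hs)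

theorem measurable_scale (t : ℝ) :
    Measurable (scale t : Measure (Fin d → ℝ) → Measure (Fin d → ℝ)) :=
  Measure.measurable_map _ (by fun_prop)

theorem scale_transl (t : ℝ) (x : Fin d → ℝ) (μ : Measure (Fin d → ℝ)) :
    scale t (transl x μ) = μ.map fun y => Real.exp t • (y - x) := by
  rw [scale, transl, Measure.map_map (by fun_prop) (by fun_prop)]
  rfl

theorem scale_transl_apply (t : ℝ) (x : Fin d → ℝ) (μ : Measure (Fin d → ℝ))
    {s : Set (Fin d → ℝ)} (hs : MeasurableSet s) :
    scale t (transl x μ) s = μ {y | Real.exp t • (y - x) ∈ s} := by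
  rw [scale_transl, Measure.map_apply (by fun_prop) hs]
  rfl

theorem measurable_scenery_uncurry :
    Measurable fun p : (Phase d × (Fin d → ℝ)) × ℝ => scenery p.1.1.1 p.1.2 p.2 := by
  simp_rw [scenery, scale_transl]
  refine (measurable_box d).comp (measurable_map_phase (measurable_fst.comp measurable_fst) ?_)
  simp only [Function.uncurry_def]
  fun_prop

theorem measurable_flow : Measurable (Function.uncurry (flow (d := d))) := by
  refine Measurable.subtype_mk (measurable_normStar.comp ?_)
  refine measurable_map_phase measurable_snd ?_
  simp only [Function.uncurry_def]
  fun_prop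

theorem measurable_translStar (μ : Measure (Fin d → ℝ)) [IsLocallyFiniteMeasure μ] :
    Measurable fun x => translStar x μ := by
  refine measurable_normStar.comp (Measure.measurable_of_measurable_coe _ fun s hs => ?_)
  have : ∀ x, transl x μ s = μ (Prod.mk x ⁻¹' {p : (Fin d → ℝ) × (Fin d → ℝ) | p.2 - p.1 ∈ s}) :=
    fun x => Measure.map_apply (by fun_prop) hs
  simp_rw [this]
  exact measurable_measure_prodMk_left
    ((by fun_prop : Measurable fun p : (Fin d → ℝ) × (Fin d → ℝ) => p.2 - p.1) hs)

theorem measurable_translStar_phase :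
    Measurable fun p : Phase d × (Fin d → ℝ) => translStar p.2 p.1.1 := by
  refine measurable_normStar.comp (measurable_map_phase measurable_fst ?_)
  simp only [Function.uncurry_def]
  fun_prop

theorem measurable_diffusion {U : Set (Fin d → ℝ)} (hU : MeasurableSet U) :
    Measurable fun μ : Phase d => diffusion U μ.1 := by
  refine Measure.measurable_of_measurable_coe _ fun s hs => ?_
  have : ∀ μ : Phase d, diffusion U μ.1 s =
      ∫⁻ x in U, {p : Phase d × (Fin d → ℝ) | translStar p.2 p.1.1 ∈ s}.indicator 1 (μ, x) ∂μ.1 := by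
    intro μ
    have hpre : MeasurableSet ((fun x => translStar x μ.1) ⁻¹' s) := measurable_translStar μ.1 hs
    rw [diffusion, Measure.map_apply (measurable_translStar μ.1) hs, ← lintegral_indicator_one hpre]
    rfl
  simp_rw [this]
  exact measurable_lintegral_phase measurable_id
    (g := fun μ x => {p : Phase d × (Fin d → ℝ) | translStar p.2 p.1.1 ∈ s}.indicator 1 (μ, x))
    (measurable_one.indicator (measurable_translStar_phase hs)) hU

end Measurability

/-! ### The scaling flow -/

section ScalingFlow

variable {d : ℕ}

theorem normStar_smul {c : ENNReal} (h0 : c ≠ 0) (ht : c ≠ ⊤) (μ : Measure (Fin d → ℝ)) :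
    normStar (c • μ) = normStar μ := by
  rw [normStar, normStar, Measure.smul_apply, smul_eq_mul, smul_smul,
    ENNReal.mul_inv (Or.inl h0) (Or.inl ht), mul_right_comm, ENNReal.inv_mul_cancel h0 ht, one_mul]

theorem box_smul {c : ENNReal} (h0 : c ≠ 0) (ht : c ≠ ⊤) (μ : Measure (Fin d → ℝ)) :
    box (c • μ) = box μ := by
  refine Subtype.ext ?_
  change boxMeasure (c • μ) = boxMeasure μ
  have e : ((c • μ) (unitBall d) ≠ 0 ∧ (c • μ) (unitBall d) ≠ ⊤) ↔
      (μ (unitBall d) ≠ 0 ∧ μ (unitBall d) ≠ ⊤) := by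
    rw [Measure.smul_apply, smul_eq_mul]
    refine and_congr (by simp [h0]) ?_
    rw [Ne, Ne, ENNReal.mul_eq_top]
    simp [h0, ht]
  rw [boxMeasure, boxMeasure]
  refine if_congr e ?_ rfl
  ext s hs
  rw [Measure.smul_apply _ (Measure.comap Subtype.val (c • μ)),
    Measure.smul_apply _ (Measure.comap Subtype.val μ), comap_val_apply _ hs, comap_val_apply _ hs,
    Measure.smul_apply, Measure.smul_apply, smul_eq_mul, smul_eq_mul, smul_eq_mul, smul_eq_mul,
    ENNReal.mul_inv (Or.inl h0) (Or.inl ht), mul_comm c⁻¹, mul_assoc, ← mul_assoc c⁻¹,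
    ENNReal.inv_mul_cancel h0 ht, one_mul]

theorem scale_smul (t : ℝ) (c : ENNReal) (μ : Measure (Fin d → ℝ)) :
    scale t (c • μ) = c • scale t μ :=
  Measure.map_smul _ _ _

theorem scale_scale (s t : ℝ) (μ : Measure (Fin d → ℝ)) : scale s (scale t μ) = scale (s + t) μ := by
  rw [scale, scale, scale, Measure.map_map (by fun_prop) (by fun_prop)]
  congr 1
  ext y
  simp [Real.exp_add, mul_assoc]

theorem scale_unitBall (t : ℝ) (μ : Measure (Fin d → ℝ)) :
    scale t μ (unitBall d) = μ (Metric.closedBall 0 (Real.exp (-t))) := by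
  rw [scale_apply t μ (measurableSet_unitBall d)]
  congr 1
  ext y
  simp only [unitBall, mem_preimage, mem_closedBall_zero_iff, norm_smul, Real.norm_eq_abs,
    Real.abs_exp, Real.exp_neg]
  rw [← mul_one (Real.exp t)⁻¹, le_inv_mul_iff₀ (Real.exp_pos t)]

theorem measure_closedBall_ne_zero {μ : Measure (Fin d → ℝ)} {x : Fin d → ℝ} (hx : x ∈ μ.support)
    {r : ℝ} (hr : 0 < r) : μ (Metric.closedBall x r) ≠ 0 :=
  ((Measure.mem_support_iff_forall x).1 hx _ (Metric.closedBall_mem_nhds x hr)).ne'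

theorem scale_unitBall_ne_zero (t : ℝ) (μ : Phase d) : scale t μ.1 (unitBall d) ≠ 0 := by
  rw [scale_unitBall]
  exact measure_closedBall_ne_zero μ.2.2.2 (Real.exp_pos _)

theorem scale_unitBall_ne_top (t : ℝ) (μ : Phase d) : scale t μ.1 (unitBall d) ≠ ⊤ := by
  rw [scale_unitBall]
  exact measure_closedBall_ne_top μ.1 _ _

theorem isMeasurableFlow_flow : IsMeasurableFlow (flow (d := d)) where
  measurable_uncurry := measurable_flow
  map_add s t μ := by
    refine Subtype.ext ?_
    change normStar (scale (s + t) μ.1) =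
      normStar (scale s ((scale t μ.1 (unitBall d))⁻¹ • scale t μ.1))
    rw [scale_smul, scale_scale, normStar_smul (ENNReal.inv_ne_zero.2 (scale_unitBall_ne_top t μ))
      (ENNReal.inv_ne_top.2 (scale_unitBall_ne_zero t μ))]
  map_zero μ := by
    refine Subtype.ext ?_
    change normStar (scale 0 μ.1) = μ.1
    have : scale 0 μ.1 = μ.1 := by simp [scale]
    rw [this, normStar, μ.2.2.1, inv_one, one_smul]

theorem box_flow (t : ℝ) (μ : Phase d) : box (flow t μ).1 = box (scale t μ.1) :=
  box_smul (ENNReal.inv_ne_zero.2 (scale_unitBall_ne_top t μ))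
    (ENNReal.inv_ne_top.2 (scale_unitBall_ne_zero t μ)) _

end ScalingFlow

/-! ### The phase space is a standard Borel space -/

section StandardBorel

variable {d : ℕ}

/-- Evaluation at a closed set is a limit of integrals of thickened indicators, which are weakly
continuous. Closed sets form a generating `π`-system, so all evaluations are Borel. -/
instance borelSpace_probabilityMeasure (d : ℕ) : BorelSpace (ProbabilityMeasure (unitBall d)) := by
  refine ⟨le_antisymm ?_ OpensMeasurableSpace.borel_le⟩
  let b : MeasurableSpace (ProbabilityMeasure (unitBall d)) := borel _
  have hb : BorelSpace (ProbabilityMeasure (unitBall d)) := ⟨rfl⟩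
  have hm : Measurable fun μ : ProbabilityMeasure (unitBall d) => (μ : Measure (unitBall d)) := by
    refine Measurable.measure_of_isPiSystem_of_isProbabilityMeasure
      (borel_eq_generateFrom_isClosed (α := unitBall d) ▸ BorelSpace.measurable_eq)
      isPiSystem_isClosed fun F hF => ?_
    refine measurable_of_tendsto_metrizable (f := fun (n : ℕ) (μ : ProbabilityMeasure (unitBall d)) =>
      ∫⁻ y, (thickenedIndicator (Nat.one_div_pos_of_nat (α := ℝ) (n := n)) F y : ENNReal)
        ∂(μ : Measure (unitBall d))) (fun n => ?_) ?_
    · have h1 := ProbabilityMeasure.continuous_testAgainstNN_eval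
        (thickenedIndicator (Nat.one_div_pos_of_nat (α := ℝ) (n := n)) F)
      have h2 := (ENNReal.continuous_coe.comp h1).measurable
      convert h2 using 1
      ext μ
      exact (FiniteMeasure.testAgainstNN_coe_eq (μ := μ.toFiniteMeasure)).symm
    · exact tendsto_pi_nhds.2 fun μ => tendsto_lintegral_thickenedIndicator_of_isClosed _ hF _
        tendsto_one_div_add_atTop_nhds_zero_nat
  exact hm.comap_le

instance polishSpace_probabilityMeasure (d : ℕ) : PolishSpace (ProbabilityMeasure (unitBall d)) := by
  let := TopologicalSpace.metrizableSpaceMetric (ProbabilityMeasure (unitBall d))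
  infer_instance

theorem measurableSet_phase (d : ℕ) : MeasurableSet {μ : Measure (Fin d → ℝ) |
    IsLocallyFiniteMeasure μ ∧ μ (unitBall d) = 1 ∧ 0 ∈ μ.support} := by
  have e : {μ : Measure (Fin d → ℝ) |
      IsLocallyFiniteMeasure μ ∧ μ (unitBall d) = 1 ∧ 0 ∈ μ.support} =
      (⋂ n : ℕ, {μ | μ (Metric.closedBall 0 (Real.exp n)) < ⊤}) ∩ ({μ | μ (unitBall d) = 1} ∩
        ⋂ n : ℕ, {μ | 0 < μ (Metric.ball 0 (1 / ((n : ℝ) + 1)))}) := by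
    ext μ
    simp only [mem_ofPred_eq, mem_inter_iff, mem_iInter]
    refine and_congr ⟨fun h n => (isCompact_closedBall 0 _).measure_lt_top, fun h => ⟨fun x => ?_⟩⟩
      (and_congr Iff.rfl ?_)
    · obtain ⟨n, hn⟩ := exists_nat_ge ‖x‖
      refine ⟨Metric.closedBall 0 (Real.exp n), ?_, h n⟩
      refine Metric.closedBall_mem_nhds_of_mem ?_
      rw [mem_ball_zero_iff]
      linarith [Real.add_one_le_exp (n : ℝ)]
    · rw [Metric.nhds_basis_ball_inv_nat_succ.mem_measureSupport]
      simp
  rw [e]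
  refine (MeasurableSet.iInter fun n => ?_).inter
    (MeasurableSet.inter ?_ (MeasurableSet.iInter fun n => ?_))
  · exact Measure.measurable_coe Metric.isClosed_closedBall.measurableSet measurableSet_Iio
  · exact Measure.measurable_coe (measurableSet_unitBall d) (measurableSet_singleton 1)
  · exact Measure.measurable_coe Metric.isOpen_ball.measurableSet measurableSet_Ioi

theorem measurableEmbedding_val (d : ℕ) :
    MeasurableEmbedding (Subtype.val : Phase d → Measure (Fin d → ℝ)) :=
  MeasurableEmbedding.subtype_coe (measurableSet_phase d)

/-- The sequence of restrictions of `μ` to the balls of radius `e^n`, rescaled to the unit ball. -/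
def boxSeq (μ : Measure (Fin d → ℝ)) (n : ℕ) : ProbabilityMeasure (unitBall d) :=
  box (scale (-n) μ)

/-- The left inverse of `boxSeq`. -/
def unboxSeq (p : ℕ → ProbabilityMeasure (unitBall d)) : Measure (Fin d → ℝ) :=
  Measure.sum fun n : ℕ =>
    ((p n : Measure (unitBall d)) {y | Real.exp n • (y : Fin d → ℝ) ∈ unitBall d})⁻¹ •
      ((p n : Measure (unitBall d)).map
        fun y : unitBall d => Real.exp n • (y : Fin d → ℝ)).restrict (annulus d n)

theorem measurable_boxSeq : Measurable (boxSeq (d := d)) :=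
  measurable_pi_lambda _ fun _ => (measurable_box d).comp (measurable_scale _)

theorem measurable_unboxSeq : Measurable (unboxSeq (d := d)) := by
  refine Measure.measurable_of_measurable_coe _ fun s hs => ?_
  simp_rw [unboxSeq, Measure.sum_apply _ hs, Measure.smul_apply, smul_eq_mul]
  refine Measurable.tsum fun n => ?_
  have hn : Measurable fun p : ℕ → ProbabilityMeasure (unitBall d) => (p n : Measure (unitBall d)) :=
    measurable_subtype_coe.comp (measurable_pi_apply n)
  have hg : Measurable fun y : unitBall d => Real.exp n • (y : Fin d → ℝ) := by fun_prop
  refine Measurable.mul ?_ ?_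
  · exact ((Measure.measurable_coe (hg (measurableSet_unitBall d))).comp hn).inv
  · simp_rw [Measure.restrict_apply hs]
    exact (Measure.measurable_coe (hs.inter (measurableSet_annulus d n))).comp
      ((Measure.measurable_map _ hg).comp hn)

theorem box_preimage_val {μ : Measure (Fin d → ℝ)} (h0 : μ (unitBall d) ≠ 0)
    (ht : μ (unitBall d) ≠ ⊤) {C : Set (Fin d → ℝ)} (hC : MeasurableSet C) :
    (box μ : Measure (unitBall d)) (Subtype.val ⁻¹' C) = (μ (unitBall d))⁻¹ * μ (C ∩ unitBall d) := by
  change boxMeasure μ _ = _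
  rw [boxMeasure, if_pos ⟨h0, ht⟩, Measure.smul_apply, comap_val_apply _ (measurable_subtype_coe hC),
    Subtype.image_preimage_coe, smul_eq_mul, inter_comm]

theorem boxSeq_apply (μ : Phase d) (n : ℕ) {C : Set (Fin d → ℝ)} (hC : MeasurableSet C)
    (hCn : C ⊆ Metric.closedBall 0 (Real.exp n)) :
    (boxSeq μ.1 n : Measure (unitBall d)) {y | Real.exp n • (y : Fin d → ℝ) ∈ C} =
      (μ.1 (Metric.closedBall 0 (Real.exp n)))⁻¹ * μ.1 C := by
  have hC' : MeasurableSet {y : Fin d → ℝ | Real.exp n • y ∈ C} :=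
    (by fun_prop : Measurable fun y : Fin d → ℝ => Real.exp n • y) hC
  refine (box_preimage_val (scale_unitBall_ne_zero _ μ) (scale_unitBall_ne_top _ μ) hC').trans ?_
  rw [scale_unitBall, neg_neg, scale_apply _ _ (hC'.inter (measurableSet_unitBall d))]
  congr 2
  ext y
  have e : Real.exp n • Real.exp (-(n : ℝ)) • y = y := by
    rw [smul_smul, ← Real.exp_add, add_neg_cancel, Real.exp_zero, one_smul]
  simp only [mem_preimage, mem_inter_iff, mem_ofPred_eq, e]
  refine ⟨fun h => h.1, fun h => ⟨h, ?_⟩⟩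
  have := mem_closedBall_zero_iff.1 (hCn h)
  rw [unitBall, mem_closedBall_zero_iff, norm_smul, Real.norm_eq_abs, Real.abs_exp, Real.exp_neg,
    inv_mul_le_iff₀ (Real.exp_pos _), mul_one]
  exact this

/-- Boxing at radius `e^n` loses only the mass of that ball. The normalization `μ (unitBall d) = 1`
restores it, and the annuli reassemble `μ` without overlap. -/
theorem unboxSeq_boxSeq (μ : Phase d) : unboxSeq (boxSeq μ.1) = μ.1 := by
  ext s hs
  have hB : unitBall d ⊆ Metric.closedBall 0 (Real.exp 0) := by
    rw [Real.exp_zero, unitBall]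
  have hterm : ∀ n : ℕ, ((boxSeq μ.1 n : Measure (unitBall d))
      {y | Real.exp n • (y : Fin d → ℝ) ∈ unitBall d})⁻¹ *
      (boxSeq μ.1 n : Measure (unitBall d)) {y | Real.exp n • (y : Fin d → ℝ) ∈ s ∩ annulus d n} =
      μ.1 (s ∩ annulus d n) := by
    intro n
    rw [boxSeq_apply μ n (measurableSet_unitBall d)
      (hB.trans (Metric.closedBall_subset_closedBall (Real.exp_le_exp.2 n.cast_nonneg))),
      boxSeq_apply μ n (hs.inter (measurableSet_annulus d n))
      (inter_subset_right.trans (annulus_subset d n)), μ.2.2.1, mul_one, inv_inv, ← mul_assoc,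
      ENNReal.mul_inv_cancel (measure_closedBall_ne_zero μ.2.2.2 (Real.exp_pos _))
        (measure_closedBall_ne_top μ.1 _ _), one_mul]
  have hg : ∀ n : ℕ, Measurable fun y : unitBall d => Real.exp n • (y : Fin d → ℝ) :=
    fun n => by fun_prop
  rw [unboxSeq, Measure.sum_apply _ hs]
  simp_rw [Measure.smul_apply, smul_eq_mul, Measure.restrict_apply hs]
  simp_rw [Measure.map_apply (hg _) (hs.inter (measurableSet_annulus d _))]
  refine (tsum_congr hterm).trans ?_
  rw [← measure_iUnion (fun i j hij => ((pairwise_disjoint_annulus d) hij).mono inter_subset_right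
    inter_subset_right) (fun n => hs.inter (measurableSet_annulus d n)), ← inter_iUnion,
    iUnion_annulus, inter_univ]

/-- A measurable left inverse makes images measurable: the image of `A` consists of the sequences
`p` with `unboxSeq p ∈ A` that are fixed by boxing after unboxing. -/
theorem measurableEmbedding_boxSeq : MeasurableEmbedding fun μ : Phase d => boxSeq μ.1 where
  injective μ ν h := Subtype.ext (by
    rw [← unboxSeq_boxSeq μ, ← unboxSeq_boxSeq ν]
    exact congrArg unboxSeq h)
  measurable := measurable_boxSeq.comp measurable_subtype_coe
  measurableSet_image' A hA := by
    have hA' : MeasurableSet (Subtype.val '' A : Set (Measure (Fin d → ℝ))) :=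
      (measurableEmbedding_val d).measurableSet_image.2 hA
    have e : (fun μ : Phase d => boxSeq μ.1) '' A =
        unboxSeq ⁻¹' (Subtype.val '' A) ∩ {p | boxSeq (unboxSeq p) = p} := by
      ext p
      constructor
      · rintro ⟨μ, hμ, rfl⟩
        simp only [mem_inter_iff, mem_preimage, mem_ofPred_eq, unboxSeq_boxSeq]
        exact ⟨⟨μ, hμ, rfl⟩, trivial⟩
      · rintro ⟨⟨μ, hμ, h1⟩, h2⟩
        refine ⟨μ, hμ, ?_⟩
        simp only
        rw [h1]
        exact h2
    rw [e]
    exact (measurable_unboxSeq hA').inter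
      (measurableSet_eq_fun (measurable_boxSeq.comp measurable_unboxSeq) measurable_id)

theorem standardBorelSpace_of_measurableEmbedding {α β : Type*} [MeasurableSpace α]
    [MeasurableSpace β] [StandardBorelSpace β] {f : α → β} (hf : MeasurableEmbedding f) :
    StandardBorelSpace α := by
  have hr : StandardBorelSpace (range f) := hf.measurableSet_range.standardBorel
  let e : α ≃ᵐ range f := hf.equivRange
  let := upgradeStandardBorel (range f)
  let t : TopologicalSpace α := TopologicalSpace.induced e inferInstance
  have h1 : BorelSpace α := ⟨by
    refine e.measurableEmbedding.comap_eq.symm.trans ?_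
    exact (congrArg (MeasurableSpace.comap e) BorelSpace.measurable_eq).trans borel_comap.symm⟩
  have h2 : PolishSpace α := e.toEquiv.polishSpace_induced
  exact ⟨t, h1, h2⟩

instance standardBorelSpace_phase (d : ℕ) : StandardBorelSpace (Phase d) :=
  standardBorelSpace_of_measurableEmbedding measurableEmbedding_boxSeq

end StandardBorel

/-! ### Averages along sceneries -/

section Sceneries

variable {d : ℕ} {g : ProbabilityMeasure (unitBall d) → ℝ} {C : ℝ}

theorem scenery_smul {c : ENNReal} (h0 : c ≠ 0) (ht : c ≠ ⊤) (μ : Measure (Fin d → ℝ))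
    (y : Fin d → ℝ) (t : ℝ) : scenery (c • μ) y t = scenery μ y t := by
  rw [scenery, transl, Measure.map_smul, scale_smul, box_smul h0 ht]
  rfl

theorem scenery_transl (x y : Fin d → ℝ) (μ : Measure (Fin d → ℝ)) (t : ℝ) :
    scenery (transl x μ) y t = scenery μ (x + y) t := by
  rw [scenery, scenery, transl, transl, transl, Measure.map_map (by fun_prop) (by fun_prop)]
  congr 3
  ext z
  simp [sub_sub]

theorem scenery_scale (s : ℝ) (y : Fin d → ℝ) (μ : Measure (Fin d → ℝ)) (t : ℝ) :
    scenery (scale s μ) (Real.exp s • y) t = scenery μ y (t + s) := by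
  rw [scenery, scenery, scale_transl, scale_transl, scale,
    Measure.map_map (by fun_prop) (by fun_prop)]
  congr 2
  ext z
  simp only [Function.comp_apply, ← smul_sub, smul_smul, Real.exp_add]

theorem scenery_flow (s : ℝ) (y : Fin d → ℝ) (μ : Phase d) (t : ℝ) :
    scenery (flow s μ).1 (Real.exp s • y) t = scenery μ.1 y (t + s) := by
  rw [← scenery_scale]
  exact scenery_smul (ENNReal.inv_ne_zero.2 (scale_unitBall_ne_top s μ))
    (ENNReal.inv_ne_top.2 (scale_unitBall_ne_zero s μ)) _ _ _

/-- This is the link between sceneries and the flow: ergodic averages of a function of `box` are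
scenery averages at the origin. -/
theorem scenery_zero (μ : Phase d) (t : ℝ) : scenery μ.1 0 t = box (flow t μ).1 := by
  rw [box_flow, scenery]
  congr 2
  simp [transl]

theorem transl_unitBall (x : Fin d → ℝ) (μ : Measure (Fin d → ℝ)) (r : ℝ) :
    transl x μ (Metric.closedBall 0 r) = μ (Metric.closedBall x r) := by
  rw [transl, Measure.map_apply (by fun_prop) Metric.isClosed_closedBall.measurableSet]
  congr 1
  ext y
  simp [dist_eq_norm]

theorem transl_mem {μ : Measure (Fin d → ℝ)} [IsLocallyFiniteMeasure μ] {x : Fin d → ℝ}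
    (hx : x ∈ μ.support) : IsLocallyFiniteMeasure (translStar x μ) ∧
      translStar x μ (unitBall d) = 1 ∧ 0 ∈ (translStar x μ).support := by
  have h0 : transl x μ (unitBall d) ≠ 0 := by
    rw [unitBall, transl_unitBall]
    exact measure_closedBall_ne_zero hx one_pos
  have ht : transl x μ (unitBall d) ≠ ⊤ := by
    rw [unitBall, transl_unitBall]
    exact measure_closedBall_ne_top μ _ _
  have h1 : (transl x μ (unitBall d))⁻¹ ≠ ⊤ := ENNReal.inv_ne_top.2 h0
  refine ⟨⟨fun y => ?_⟩, ENNReal.inv_mul_cancel h0 ht, ?_⟩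
  · refine ⟨Metric.closedBall 0 (‖y‖ + 1), Metric.closedBall_mem_nhds_of_mem ?_, ?_⟩
    · rw [mem_ball_zero_iff]
      linarith
    · rw [translStar, normStar, Measure.smul_apply, transl_unitBall, smul_eq_mul]
      exact ENNReal.mul_lt_top h1.lt_top (measure_closedBall_ne_top μ _ _).lt_top
  · refine Metric.nhds_basis_closedBall.mem_measureSupport.2 fun r hr => ?_
    rw [translStar, normStar, Measure.smul_apply, transl_unitBall, smul_eq_mul]
    exact ENNReal.mul_pos (ENNReal.inv_ne_zero.2 ht) (measure_closedBall_ne_zero hx hr)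

theorem scenery_translStar {μ : Measure (Fin d → ℝ)} [IsLocallyFiniteMeasure μ] {x : Fin d → ℝ}
    (hx : x ∈ μ.support) (y : Fin d → ℝ) (t : ℝ) :
    scenery (translStar x μ) y t = scenery μ (x + y) t := by
  rw [← scenery_transl]
  refine scenery_smul (ENNReal.inv_ne_zero.2 ?_) (ENNReal.inv_ne_top.2 ?_) _ _ _
  · rw [unitBall, transl_unitBall]
    exact measure_closedBall_ne_top μ _ _
  · rw [unitBall, transl_unitBall]
    exact measure_closedBall_ne_zero hx one_pos

/-- The upper limit of the averages of `g` along the scenery of `μ` at `x`. -/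
def sceneryLimsup (g : ProbabilityMeasure (unitBall d) → ℝ) (μ : Measure (Fin d → ℝ))
    (x : Fin d → ℝ) : ℝ :=
  cesaroLimsup fun t => g (scenery μ x t)

theorem measurable_sceneryLimsup (hg : Measurable g) :
    Measurable fun p : Phase d × (Fin d → ℝ) => sceneryLimsup g p.1.1 p.2 :=
  measurable_cesaroLimsup (hg.comp measurable_scenery_uncurry)

theorem abs_sceneryLimsup_le (hC : ∀ p, |g p| ≤ C) (μ : Measure (Fin d → ℝ)) (x : Fin d → ℝ) :
    |sceneryLimsup g μ x| ≤ C :=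
  abs_cesaroLimsup_le fun _ => hC _

theorem sceneryLimsup_flow (hg : Measurable g) (hC : ∀ p, |g p| ≤ C) (s : ℝ) (μ : Phase d)
    (y : Fin d → ℝ) :
    sceneryLimsup g (flow s μ).1 (Real.exp s • y) = sceneryLimsup g μ.1 y := by
  simp_rw [sceneryLimsup, scenery_flow]
  exact cesaroLimsup_shift (hg.comp (measurable_scenery μ.1 y)) (fun _ => hC _) s

theorem sceneryLimsup_translStar {μ : Measure (Fin d → ℝ)} [IsLocallyFiniteMeasure μ]
    {x : Fin d → ℝ} (hx : x ∈ μ.support) (y : Fin d → ℝ) :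
    sceneryLimsup g (translStar x μ) y = sceneryLimsup g μ (x + y) := by
  simp_rw [sceneryLimsup, scenery_translStar hx]

/-- The mean oscillation of the scenery averages around the origin. -/
def oscillation (g : ProbabilityMeasure (unitBall d) → ℝ) (μ : Measure (Fin d → ℝ)) : ENNReal :=
  ∫⁻ y in unitBall d, ‖sceneryLimsup g μ y - sceneryLimsup g μ 0‖ₑ ∂μ

theorem measurable_oscillation (hg : Measurable g) :
    Measurable fun μ : Phase d => oscillation g μ.1 := by
  have hH := measurable_sceneryLimsup hg
  refine measurable_lintegral_phase measurable_id
    (g := fun μ y => ‖sceneryLimsup g μ.1 y - sceneryLimsup g μ.1 0‖ₑ) ?_ (measurableSet_unitBall d)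
  exact (hH.sub (hH.comp (measurable_fst.prodMk measurable_const))).enorm

theorem oscillation_le (hC : ∀ p, |g p| ≤ C) (μ : Phase d) :
    oscillation g μ.1 ≤ ENNReal.ofReal (2 * C) := by
  calc oscillation g μ.1 ≤ ∫⁻ _ in unitBall d, ENNReal.ofReal (2 * C) ∂μ.1 := by
        refine lintegral_mono fun y => ?_
        rw [Real.enorm_eq_ofReal_abs]
        refine ENNReal.ofReal_le_ofReal ((abs_sub _ _).trans ?_)
        linarith [abs_sceneryLimsup_le hC μ.1 y, abs_sceneryLimsup_le hC μ.1 0]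
    _ = ENNReal.ofReal (2 * C) := by
        rw [setLIntegral_const, μ.2.2.1, mul_one]

theorem measurable_sceneryLimsup_right (hg : Measurable g) (μ : Measure (Fin d → ℝ))
    [IsLocallyFiniteMeasure μ] : Measurable (sceneryLimsup g μ) := by
  refine measurable_cesaroLimsup (hg.comp ((measurable_box d).comp
    (Measure.measurable_of_measurable_coe _ fun s hs => ?_)))
  simp_rw [scale_transl_apply _ _ _ hs]
  exact measurable_measure_prodMk_left
    ((by fun_prop : Measurable fun q : ((Fin d → ℝ) × ℝ) × (Fin d → ℝ) =>
      Real.exp q.1.2 • (q.2 - q.1.1)) hs)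

/-- Magnification only shifts the time of a scenery, which does not affect the upper limit of
averages. So the oscillation at scale `s` is a mean over the ball of radius `e^{-s}`. -/
theorem oscillation_flow (hg : Measurable g) (hC : ∀ p, |g p| ≤ C) (s : ℝ) (μ : Phase d) :
    oscillation g (flow s μ).1 = (∫⁻ y in Metric.closedBall 0 (Real.exp (-s)),
      ‖sceneryLimsup g μ.1 y - sceneryLimsup g μ.1 0‖ₑ ∂μ.1) /
        μ.1 (Metric.closedBall 0 (Real.exp (-s))) := by
  have hm : Measurable fun y => ‖sceneryLimsup g (flow s μ).1 y -
      sceneryLimsup g (flow s μ).1 0‖ₑ :=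
    ((measurable_sceneryLimsup_right hg (flow s μ).1).sub_const _).enorm
  have hs : Measurable fun y : Fin d → ℝ => Real.exp s • y := by fun_prop
  have e0 : sceneryLimsup g (flow s μ).1 0 = sceneryLimsup g μ.1 0 := by
    simpa using sceneryLimsup_flow hg hC s μ 0
  have e : (flow s μ).1 = (scale s μ.1 (unitBall d))⁻¹ • scale s μ.1 := rfl
  have hpre : (fun y : Fin d → ℝ => Real.exp s • y) ⁻¹' unitBall d =
      Metric.closedBall 0 (Real.exp (-s)) := by
    ext y
    rw [mem_preimage, unitBall, mem_closedBall_zero_iff, mem_closedBall_zero_iff, norm_smul,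
      Real.norm_eq_abs, Real.abs_exp, Real.exp_neg, ← mul_one (Real.exp s)⁻¹,
      le_inv_mul_iff₀ (Real.exp_pos s)]
  have h1 : oscillation g (flow s μ).1 = (scale s μ.1 (unitBall d))⁻¹ *
      ∫⁻ y in unitBall d, ‖sceneryLimsup g (flow s μ).1 y -
        sceneryLimsup g (flow s μ).1 0‖ₑ ∂(scale s μ.1) := by
    rw [oscillation]
    conv_lhs => rw [show ((flow s μ).1.restrict (unitBall d)) =
      (scale s μ.1 (unitBall d))⁻¹ • (scale s μ.1).restrict (unitBall d) by
        rw [← Measure.restrict_smul, ← e]]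
    rw [lintegral_smul_measure, smul_eq_mul]
  rw [h1, scale_unitBall, scale, setLIntegral_map (measurableSet_unitBall d) hm hs, hpre,
    ENNReal.div_eq_inv_mul]
  simp_rw [sceneryLimsup_flow hg hC, e0]

theorem setLIntegral_transl {x : Fin d → ℝ} {μ : Measure (Fin d → ℝ)} {r : ℝ}
    {f : (Fin d → ℝ) → ENNReal} (hf : Measurable f) :
    ∫⁻ y in Metric.closedBall 0 r, f (x + y) ∂(transl x μ) =
      ∫⁻ y in Metric.closedBall x r, f y ∂μ := by
  have hpre : (fun y => y - x) ⁻¹' Metric.closedBall 0 r = Metric.closedBall x r := by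
    ext y
    simp [dist_eq_norm]
  rw [transl, setLIntegral_map Metric.isClosed_closedBall.measurableSet (by fun_prop)
    (by fun_prop), hpre]
  simp

theorem oscillation_flow_translStar (hg : Measurable g) (hC : ∀ p, |g p| ≤ C)
    {μ : Measure (Fin d → ℝ)} [IsLocallyFiniteMeasure μ] {x : Fin d → ℝ} (hx : x ∈ μ.support)
    (s : ℝ) {ν : Phase d} (hν : ν.1 = translStar x μ) :
    oscillation g (flow s ν).1 = (∫⁻ y in Metric.closedBall x (Real.exp (-s)),
      ‖sceneryLimsup g μ y - sceneryLimsup g μ x‖ₑ ∂μ) /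
        μ (Metric.closedBall x (Real.exp (-s))) := by
  have h0 : transl x μ (unitBall d) ≠ 0 := by
    rw [unitBall, transl_unitBall]
    exact measure_closedBall_ne_zero hx one_pos
  have ht : transl x μ (unitBall d) ≠ ⊤ := by
    rw [unitBall, transl_unitBall]
    exact measure_closedBall_ne_top μ _ _
  have hm : Measurable fun y => ‖sceneryLimsup g μ y - sceneryLimsup g μ x‖ₑ :=
    ((measurable_sceneryLimsup_right hg μ).sub_const _).enorm
  rw [oscillation_flow hg hC, hν]
  simp_rw [sceneryLimsup_translStar hx, add_zero]
  rw [translStar, normStar, Measure.restrict_smul, lintegral_smul_measure, Measure.smul_apply,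
    smul_eq_mul, smul_eq_mul, transl_unitBall, setLIntegral_transl hm]
  exact ENNReal.mul_div_mul_left _ _ (ENNReal.inv_ne_zero.2 ht) (ENNReal.inv_ne_top.2 h0)

/-- Lebesgue points for arbitrary Radon measures. -/
theorem ae_tendsto_oscillation_translStar (hg : Measurable g) (hC : ∀ p, |g p| ≤ C)
    (μ : Measure (Fin d → ℝ)) [IsLocallyFiniteMeasure μ] :
    ∀ᵐ x ∂μ, ∀ ν : Phase d, ν.1 = translStar x μ →
      Tendsto (fun n : ℕ => oscillation g (flow n ν).1) atTop (𝓝 0) := by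
  have hloc : LocallyIntegrable (sceneryLimsup g μ) μ :=
    (locallyIntegrable_const C).mono
      (measurable_sceneryLimsup_right hg μ).aestronglyMeasurable
      (Eventually.of_forall fun x => by
        simpa [Real.norm_eq_abs] using (abs_sceneryLimsup_le hC μ x).trans (le_abs_self C))
  have hr : Tendsto (fun n : ℕ => Real.exp (-(n : ℝ))) atTop (𝓝[>] 0) :=
    tendsto_nhdsWithin_iff.2 ⟨(Real.tendsto_exp_neg_atTop_nhds_zero).comp
      tendsto_natCast_atTop_atTop, Eventually.of_forall fun n => Real.exp_pos _⟩
  -- Besicovitch's covering theorem gives differentiation along centred balls for every locally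
  -- finite measure, without a doubling condition.
  filter_upwards [(Besicovitch.vitaliFamily μ).ae_tendsto_lintegral_enorm_sub_div hloc,
    Measure.support_mem_ae (μ := μ)] with x hx hxs ν hν
  have h1 := hx.comp ((Besicovitch.tendsto_filterAt μ x).comp hr)
  refine h1.congr fun n => ?_
  exact (oscillation_flow_translStar hg hC hxs n hν).symm

end Sceneries

/-! ### Consequences of the quasi-Palm property -/

section QuasiPalm

variable {d : ℕ} {P : ProbabilityMeasure (Phase d)}

/-- One half of quasi-Palm, over balls exhausting the space: what is typical at the origin is
typical at `μ`-almost every point. Quantifying over `ν` avoids points outside the support, where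
`translStar x μ` need not lie in the phase space. -/
theorem ae_translStar_of_ae (hP : IsQuasiPalm P) {p : Phase d → Prop}
    (hp : ∀ᵐ μ ∂(P : Measure (Phase d)), p μ) :
    ∀ᵐ μ ∂(P : Measure (Phase d)), ∀ᵐ x ∂μ.1, ∀ ν : Phase d, ν.1 = translStar x μ.1 → p ν := by
  have hmap : ∀ᵐ m ∂(P : Measure (Phase d)).map Subtype.val, ∀ ν : Phase d, ν.1 = m → p ν := by
    rw [(measurableEmbedding_val d).ae_map_iff]
    filter_upwards [hp] with μ hμ ν hν
    rwa [Subtype.ext hν]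
  have hn : ∀ n : ℕ, ∀ᵐ μ ∂(P : Measure (Phase d)),
      ∀ᵐ x ∂(μ.1.restrict (Metric.ball 0 ((n : ℝ) + 1))),
        ∀ ν : Phase d, ν.1 = translStar x μ.1 → p ν := by
    intro n
    have hac := (hP (Metric.ball 0 ((n : ℝ) + 1)) Metric.isOpen_ball Metric.isBounded_ball
      (Metric.mem_ball_self (by positivity))).2
    have h1 := Measure.ae_ae_of_ae_bind
      (measurable_diffusion Metric.isOpen_ball.measurableSet).aemeasurable (hac.ae_le hmap)
    filter_upwards [h1] with μ hμ
    exact ae_of_ae_map (measurable_translStar μ.1).aemeasurable hμ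
  filter_upwards [ae_all_iff.2 hn] with μ hμ
  have := (ae_restrict_iUnion_iff _ _).2 hμ
  have hun : ⋃ n : ℕ, Metric.ball (0 : Fin d → ℝ) ((n : ℝ) + 1) = univ := by
    refine eq_univ_of_forall fun y => ?_
    obtain ⟨n, hn⟩ := exists_nat_ge ‖y‖
    exact mem_iUnion.2 ⟨n, mem_ball_zero_iff.2 (by linarith)⟩
  rwa [hun, Measure.restrict_univ] at this

/-- The converse half of quasi-Palm: what holds at almost every point of every measure holds at the
origin of almost every measure. -/
theorem ae_of_ae_translStar (hP : IsQuasiPalm P) {p : Phase d → Prop}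
    (hpm : MeasurableSet {μ | p μ})
    (hp : ∀ μ : Phase d, ∀ᵐ x ∂μ.1, ∀ ν : Phase d, ν.1 = translStar x μ.1 → p ν) :
    ∀ᵐ μ ∂(P : Measure (Phase d)), p μ := by
  have hemb := measurableEmbedding_val d
  have hac := (hP (Metric.ball 0 1) Metric.isOpen_ball Metric.isBounded_ball
    (Metric.mem_ball_self one_pos)).1
  have hN : MeasurableSet (Subtype.val '' {μ : Phase d | p μ}ᶜ : Set (Measure (Fin d → ℝ))) :=
    hemb.measurableSet_image.2 hpm.compl
  have h0 : (P : Measure (Phase d)).map Subtype.val (Subtype.val '' {μ : Phase d | p μ}ᶜ) = 0 := by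
    refine hac ?_
    rw [Measure.bind_apply hN (measurable_diffusion Metric.isOpen_ball.measurableSet).aemeasurable]
    refine (lintegral_congr fun μ => ?_).trans lintegral_zero
    rw [diffusion, Measure.map_apply (measurable_translStar μ.1) hN]
    refine measure_mono_null ?_ (ae_iff.1 (ae_restrict_of_ae (hp μ)))
    rintro x ⟨ν, hν, h⟩ hall
    exact hν (hall ν h)
  rw [hemb.map_apply, preimage_image_eq _ Subtype.val_injective] at h0
  exact h0

/-- Along the flow the oscillation tends to `0` almost surely and stays bounded, so its expectation
tends to `0`. By scale invariance that expectation does not change with time. -/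
theorem ae_oscillation_eq_zero (hP : IsFractalDistribution P)
    {g : ProbabilityMeasure (unitBall d) → ℝ} (hg : Measurable g) {C : ℝ} (hC : ∀ p, |g p| ≤ C) :
    ∀ᵐ μ ∂(P : Measure (Phase d)), oscillation g μ.1 = 0 := by
  have hm := measurable_oscillation hg
  have hlim : ∀ᵐ μ ∂(P : Measure (Phase d)),
      Tendsto (fun n : ℕ => oscillation g (flow n μ).1) atTop (𝓝 0) :=
    ae_of_ae_translStar hP.2
      (measurableSet_tendsto _ fun n => hm.comp (isMeasurableFlow_flow.measurable n))
      fun μ => ae_tendsto_oscillation_translStar hg hC μ.1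
  have h1 := tendsto_lintegral_of_dominated_convergence (fun _ => ENNReal.ofReal (2 * C))
    (fun n : ℕ => hm.comp (isMeasurableFlow_flow.measurable n))
    (fun n => Eventually.of_forall fun μ => oscillation_le hC (flow n μ))
    (by rw [lintegral_const]; finiteness) hlim
  have h2 : ∀ n : ℕ, ∫⁻ μ, ((fun μ : Phase d => oscillation g μ.1) ∘ flow n) μ
      ∂(P : Measure (Phase d)) = ∫⁻ μ, oscillation g μ.1 ∂(P : Measure (Phase d)) :=
    fun n => (hP.1 n).lintegral_comp hm
  have h3 := tendsto_nhds_unique (h1.congr h2) tendsto_const_nhds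
  rw [lintegral_zero] at h3
  exact (lintegral_eq_zero_iff hm).1 h3.symm

/-- The scenery averages of a typical measure agree at almost every point. -/
theorem ae_sceneryLimsup_eq (hP : IsFractalDistribution P)
    {g : ProbabilityMeasure (unitBall d) → ℝ} (hg : Measurable g) {C : ℝ} (hC : ∀ p, |g p| ≤ C) :
    ∀ᵐ μ ∂(P : Measure (Phase d)), ∀ᵐ x ∂μ.1, sceneryLimsup g μ.1 x = sceneryLimsup g μ.1 0 := by
  have h0 := ae_oscillation_eq_zero hP hg hC
  -- Negative times zoom out: vanishing at time `-n` concerns the ball of radius `e^n`, and these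
  -- balls exhaust the space.
  have hn : ∀ n : ℕ, ∀ᵐ μ ∂(P : Measure (Phase d)), oscillation g (flow (-n) μ).1 = 0 :=
    fun n => (hP.1 (-n)).quasiMeasurePreserving.ae h0
  filter_upwards [ae_all_iff.2 hn] with μ hμ
  have hb : ∀ n : ℕ, ∀ᵐ x ∂(μ.1.restrict (Metric.closedBall 0 (Real.exp n))),
      sceneryLimsup g μ.1 x = sceneryLimsup g μ.1 0 := by
    intro n
    have h1 := hμ n
    rw [oscillation_flow hg hC, neg_neg, ENNReal.div_eq_zero_iff] at h1
    have h2 := h1.resolve_right (measure_closedBall_ne_top μ.1 _ _)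
    rw [lintegral_eq_zero_iff ((measurable_sceneryLimsup_right hg μ.1).sub_const _).enorm] at h2
    filter_upwards [h2] with x hx
    simpa [sub_eq_zero] using hx
  have := (ae_restrict_iUnion_iff _ _).2 hb
  rwa [iUnion_closedBall_exp, Measure.restrict_univ] at this

end QuasiPalm

/-! ### Generated distributions -/

section Generation

variable {d : ℕ}

theorem integral_sceneryDist (μ : Measure (Fin d → ℝ)) [IsLocallyFiniteMeasure μ] (x : Fin d → ℝ)
    {T : ℝ} (hT : 0 < T) {g : ProbabilityMeasure (unitBall d) → ℝ} (hg : Measurable g) :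
    ∫ p, g p ∂(sceneryDist μ x T : Measure (ProbabilityMeasure (unitBall d))) =
      cesaro (fun t => g (scenery μ x t)) T := by
  change ∫ p, g p ∂(sceneryMeasure μ x T) = _
  rw [sceneryMeasure, if_pos hT, integral_smul_measure,
    integral_map (measurable_scenery μ x).aemeasurable hg.aestronglyMeasurable, cesaro,
    intervalIntegral.integral_of_le hT.le, integral_Icc_eq_integral_Ioc, ENNReal.toReal_inv,
    ENNReal.toReal_ofReal hT.le, smul_eq_mul]

theorem abs_apply_le_norm {K : Type*} [TopologicalSpace K] [CompactSpace K] (g : C(K, ℝ)) (p : K) :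
    |g p| ≤ ‖g‖ :=
  g.norm_coe_le_norm p

/-- A `3ε` argument: integrals against probability measures are 1-Lipschitz in the test function. A
countable `D` lets the exceptional null sets be chosen independently of the test function. -/
theorem generatesAt_of_dense {μ : Measure (Fin d → ℝ)} [IsLocallyFiniteMeasure μ] {x : Fin d → ℝ}
    (hx : x ∈ μ.support) {Q : ProbabilityMeasure (ProbabilityMeasure (unitBall d))}
    {D : Set C(ProbabilityMeasure (unitBall d), ℝ)} (hD : Dense D)
    (h : ∀ g ∈ D, Tendsto (fun n : ℕ => cesaro (fun t => g (scenery μ x t)) n) atTop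
      (𝓝 (∫ p, g p ∂(Q : Measure (ProbabilityMeasure (unitBall d)))))) : GeneratesAt μ x Q := by
  refine ⟨hx, ProbabilityMeasure.tendsto_iff_forall_integral_tendsto.2 fun f => ?_⟩
  have hint : ∀ (g : C(ProbabilityMeasure (unitBall d), ℝ))
      (R : ProbabilityMeasure (ProbabilityMeasure (unitBall d))),
      Integrable g (R : Measure (ProbabilityMeasure (unitBall d))) := fun g R =>
    Integrable.of_bound g.continuous.measurable.aestronglyMeasurable ‖g‖
      (Eventually.of_forall g.norm_coe_le_norm)
  have hdist : ∀ (g g' : C(ProbabilityMeasure (unitBall d), ℝ))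
      (R : ProbabilityMeasure (ProbabilityMeasure (unitBall d))),
      |∫ p, g p ∂(R : Measure (ProbabilityMeasure (unitBall d))) -
        ∫ p, g' p ∂(R : Measure (ProbabilityMeasure (unitBall d)))| ≤ dist g g' := by
    intro g g' R
    rw [← integral_sub (hint g R) (hint g' R), dist_eq_norm]
    simpa using norm_integral_le_of_norm_le_const
      (μ := (R : Measure (ProbabilityMeasure (unitBall d)))) (f := fun p => g p - g' p)
      (Eventually.of_forall fun p => (g - g').norm_coe_le_norm p)
  have hlim : ∀ g ∈ D, Tendsto
      (fun T : ℝ => ∫ p, g p ∂(sceneryDist μ x T : Measure (ProbabilityMeasure (unitBall d)))) atTop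
      (𝓝 (∫ p, g p ∂(Q : Measure (ProbabilityMeasure (unitBall d))))) := by
    intro g hg
    refine (tendsto_cesaro_of_nat (g.continuous.measurable.comp (measurable_scenery μ x))
      (fun t => abs_apply_le_norm g _) (h g hg)).congr' ?_
    filter_upwards [eventually_gt_atTop 0] with T hT
    exact (integral_sceneryDist μ x hT g.continuous.measurable).symm
  rw [Metric.tendsto_nhds]
  intro ε hε
  obtain ⟨g, hgD, hg⟩ := hD.exists_dist_lt f.toContinuousMap (show 0 < ε / 3 by positivity)
  filter_upwards [Metric.tendsto_nhds.1 (hlim g hgD) (ε / 3) (by positivity)] with T hT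
  have h1 := (hdist f.toContinuousMap g (sceneryDist μ x T)).trans_lt hg
  have h2 := (hdist f.toContinuousMap g Q).trans_lt hg
  rw [abs_sub_comm, ← Real.dist_eq] at h2
  rw [← Real.dist_eq] at h1
  calc _ < ε / 3 + ε / 3 + ε / 3 :=
        (dist_triangle4 _ _ _ _).trans_lt (add_lt_add (add_lt_add h1 hT) h2)
    _ = ε := by ring

theorem integral_restricted (Q : ProbabilityMeasure (Phase d))
    {g : ProbabilityMeasure (unitBall d) → ℝ} (hg : Measurable g) :
    ∫ p, g p ∂(restricted Q : Measure (ProbabilityMeasure (unitBall d))) =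
      ∫ ν : Phase d, g (box ν.1) ∂(Q : Measure (Phase d)) :=
  integral_map ((measurable_box d).comp measurable_subtype_coe).aemeasurable
    hg.aestronglyMeasurable

variable {P : ProbabilityMeasure (Phase d)} {κ : Phase d → ProbabilityMeasure (Phase d)}

theorem ae_tendsto_cesaro_scenery (hP : IsFractalDistribution P)
    (hκ : IsInvariantDisintegration flow P κ) (g : C(ProbabilityMeasure (unitBall d), ℝ)) :
    ∀ᵐ μ ∂(P : Measure (Phase d)), ∀ᵐ x ∂μ.1,
      Tendsto (fun n : ℕ => cesaro (fun t => g (scenery μ.1 x t)) n) atTop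
        (𝓝 (∫ p, g p ∂(restricted (κ μ) : Measure (ProbabilityMeasure (unitBall d))))) := by
  have hg := g.continuous.measurable
  have h0 : ∀ᵐ μ ∂(P : Measure (Phase d)),
      Tendsto (fun n : ℕ => cesaro (fun t => g (scenery μ.1 0 t)) n) atTop
        (𝓝 (∫ p, g p ∂(restricted (κ μ) : Measure (ProbabilityMeasure (unitBall d))))) := by
    simp_rw [scenery_zero, integral_restricted _ hg]
    exact hκ.tendsto_cesaro isMeasurableFlow_flow hP.1
      (hg.comp ((measurable_box d).comp measurable_subtype_coe)) fun μ => abs_apply_le_norm g _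
  -- The limit is renamed as `sceneryLimsup`, which mentions only `μ`. After recentring at `x` it
  -- becomes the value at `x`, whereas the relation between the components of `μ` and of `translStar
  -- x μ` is not known beforehand.
  have h1 : ∀ᵐ μ ∂(P : Measure (Phase d)),
      Tendsto (fun n : ℕ => cesaro (fun t => g (scenery μ.1 0 t)) n) atTop
        (𝓝 (sceneryLimsup g μ.1 0)) := by
    filter_upwards [h0] with μ hμ
    rwa [sceneryLimsup, cesaroLimsup, hμ.limsup_eq]
  filter_upwards [h0, ae_translStar_of_ae hP.2 h1,
    ae_sceneryLimsup_eq hP hg (abs_apply_le_norm g)] with μ h0 h1 h2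
  filter_upwards [h1, h2, Measure.support_mem_ae (μ := μ.1)] with x h1 h2 hx
  have h3 := h1 ⟨translStar x μ.1, transl_mem hx⟩ rfl
  simp_rw [sceneryLimsup_translStar hx, scenery_translStar hx, add_zero, h2] at h3
  rwa [sceneryLimsup, cesaroLimsup, h0.limsup_eq] at h3

theorem ae_isUSMGenerating (hP : IsFractalDistribution P)
    (hκ : IsInvariantDisintegration flow P κ) :
    ∀ᵐ μ ∂(P : Measure (Phase d)), IsUSMGenerating μ.1 (restricted (κ μ)) := by
  obtain ⟨D, hDc, hD⟩ :=
    TopologicalSpace.exists_countable_dense C(ProbabilityMeasure (unitBall d), ℝ)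
  have h := (ae_ball_iff hDc).2 fun g _ => ae_tendsto_cesaro_scenery hP hκ g
  filter_upwards [h] with μ hμ
  filter_upwards [(ae_ball_iff hDc).2 hμ, Measure.support_mem_ae (μ := μ.1)] with x hx hxs
  exact generatesAt_of_dense hxs hD hx

/-! ### Ergodic decompositions as disintegrations, and the ergodic case -/

theorem IsErgodicDecomposition.isInvariantDisintegration (h : IsErgodicDecomposition P κ) :
    IsInvariantDisintegration flow P κ :=
  isInvariantDisintegration_of_carried h.measurable h.barycenter h.ae_carried

theorem exists_isErgodicDecomposition (hP : IsScaleInvariant P) :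
    ∃ κ, IsErgodicDecomposition P κ := by
  obtain ⟨κ, hκ⟩ := exists_isInvariantDisintegration (flow (d := d)) P
  exact ⟨κ, hκ.measurable, hκ.bind_eq, hκ.ae_invariant isMeasurableFlow_flow hP,
    hκ.ae_ergodic isMeasurableFlow_flow hP, fun A hA => hκ.carried hA⟩

/-- Invariant sets have probability `0` or `1`. A null one contains almost no `μ`, so the last
condition is vacuous there. -/
theorem isErgodicDecomposition_const (hP : IsScaleInvariant P) (hE : IsErgodicDist P) :
    IsErgodicDecomposition P fun _ => P where
  measurable := @measurable_const _ _ _ (invariantSets d) _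
  barycenter := by simp
  ae_invariant := Eventually.of_forall fun _ => hP
  ae_ergodic := Eventually.of_forall fun _ => hE
  ae_carried A hA := by
    obtain ⟨hA1, hA2⟩ := measurableSet_flowInvariants.1 hA
    rcases hE A hA1 fun t => by simp [hA2 t] with h | h
    · filter_upwards [measure_eq_zero_iff_ae_notMem.1 h] with μ hμ hμ'
      exact absurd hμ' hμ
    · exact Eventually.of_forall fun _ _ => h

end Generation

end

end FractalDist

theorem mainTheorem4 (d : ℕ) (P : ProbabilityMeasure (FractalDist.Phase d))
    (hP : FractalDist.IsFractalDistribution P) :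
    (∃ κ : FractalDist.Phase d → ProbabilityMeasure (FractalDist.Phase d),
      FractalDist.IsErgodicDecomposition P κ) ∧
    (∀ κ : FractalDist.Phase d → ProbabilityMeasure (FractalDist.Phase d),
      FractalDist.IsErgodicDecomposition P κ →
        ∀ᵐ μ ∂(P : Measure (FractalDist.Phase d)),
          FractalDist.IsUSMGenerating μ.1 (FractalDist.restricted (κ μ))) ∧
    (FractalDist.IsErgodicDist P →
      ∀ᵐ μ ∂(P : Measure (FractalDist.Phase d)),
        FractalDist.IsUSMGenerating μ.1 (FractalDist.restricted P)) :=
  ⟨FractalDist.exists_isErgodicDecomposition hP.1,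
    fun _ hκ => FractalDist.ae_isUSMGenerating hP hκ.isInvariantDisintegration,
    fun hE => FractalDist.ae_isUSMGenerating hP
      (FractalDist.isErgodicDecomposition_const hP.1 hE).isInvariantDisintegration⟩
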